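/- Let $N\ge 1$, let $\mu,\nu$ be Borel probability measures on $\mathbb{R}^N$, and let $c:\mathbb{R}^N\times\mathbb{R}^N\to(-\infty,+\infty]$ be Borel and bounded from below. For $0\le t<N$ let $\mu^{x_1,\dots,x_t}(dx_{t+1},\dots,dx_N)$ be a version of the regular conditional kernel of $\mu$ with respect to its first $t$ coordinates, defined for every $(x_1,\dots,x_t)\in\mathbb{R}^t$ (for $t=0$ this is $\mu$ itself), and write $\mu^{x_1,\dots,x_t}(dx_{t+1})$ for its first marginal; similarly for $\nu$. $\Pi(p,q)$ denotes the set of couplings of two probability measures $p,q$. A coupling $\gamma\in\Pi(\mu,\nu)$, with regular kernel $\gamma^x(dy)$ given the first component, is causal, $\gamma\in\Pi_c(\mu,\nu)$, if for every $t\in\{1,\dots,N\}$ and every Borel set $B$ depending only on $(y_1,\dots,y_t)$ the map $x\mapsto\gamma^x(B)$ agrees outside a $\mu$-null set with a measurable function of $(x_1,\dots,x_t)$. It is bicausal, $\gamma\in\Pi_{bc}(\mu,\nu)$, if moreover its image under $(x,y)\mapsto(y,x)$ is in $\Pi_c(\nu,\mu)$. Define $V_N:=c$ and, for $t=N-1,\dots,1$,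 $$V_t(x_1,\dots,x_t,y_1,\dots,y_t):=\inf_{\gamma\in\Pi(\mu^{x_1,\dots,x_t}(dx_{t+1}),\,\nu^{y_1,\dots,y_t}(dy_{t+1}))}\int V_{t+1}(x_1,\dots,x_{t+1},y_1,\dots,y_{t+1})\,\gamma(dx_{t+1},dy_{t+1}),$$ and $V_0:=\inf_{\gamma\in\Pi(p^1_*\mu,p^1_*\nu)}\int V_1(x_1,y_1)\,\gamma(dx_1,dy_1)$, where $p^1$ is the first coordinate. (a) For every choice of the versions of the kernels, the recursion is well-defined: for all $0\le t<N$, all $x_1,\dots,x_t,y_1,\dots,y_t\in\mathbb{R}$ and all $\gamma$ admissible in the infimum defining $V_t(x_1,\dots,x_t,y_1,\dots,y_t)$, the function $(x_{t+1},y_{t+1})\mapsto V_{t+1}(x_1,\dots,x_{t+1},y_1,\dots,y_{t+1})$ is measurable with respect to the $\gamma$-completion of the Borel $\sigma$-algebra and has integrable negative part. Moreover the following three values coincide: the value of the nested problem $$\inf_{\gamma^1\in\Pi(p^1_*\mu,p^1_*\nu)}\int\gamma^1(dx_1,dy_1)\inf_{\gamma^2\in\Pi(\mu^{x_1},\nu^{y_1})}\int\gamma^2(dx_2,dy_2)\cdots\inf_{\gamma^N\in\Pi(\mu^{x_1,\dots,x_{N-1}},\nu^{y_1,\dots,y_{N-1}})}\int\gamma^N(dx_N,dy_N)\,c(x_1,\dots,x_N,y_1,\dots,y_N),$$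 the number $V_0$, and the bicausal optimal transport value $\inf_{\gamma\in\Pi_{bc}(\mu,\nu)}\int c\,d\gamma$. (b) Call $\mu$ successively weakly continuous if the versions can be chosen such that, for each $t<N$, the map $(x_1,\dots,x_t)\mapsto\mu^{x_1,\dots,x_t}(dx_{t+1},\dots,dx_N)$ is weakly continuous on $S_t(\mu):=\{(x_1,\dots,x_t):x\in\operatorname{supp}\mu\}$; similarly for $\nu$. Suppose in addition that $c$ is lower semicontinuous on $\operatorname{supp}\mu\times\operatorname{supp}\nu$ and that both $\mu$ and $\nu$ are successively weakly continuous. Then the infimum $\inf_{\gamma\in\Pi_{bc}(\mu,\nu)}\int c\,d\gamma$ is attained, and, for any such weakly continuous versions of the kernels, every value function $V_t$, $0\le t\le N$, is lower semicontinuous on $S_t(\mu)\times S_t(\nu)$. -/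

import Mathlib

open MeasureTheory ProbabilityTheory

noncomputable section

namespace BicausalOT

/-! ### Integrals of extended-real functions and couplings -/

/-- `∫ f dγ := ∫ f⁺ dγ - ∫ f⁻ dγ` for a function with values in `[-∞, ∞]`. -/
def extIntegral {α : Type*} [MeasurableSpace α] (γ : Measure α) (f : α → EReal) : EReal :=
  ((∫⁻ a, (f a).toENNReal ∂γ : ENNReal) : EReal) - ((∫⁻ a, (-f a).toENNReal ∂γ : ENNReal) : EReal)

/-- The integral of `f` with respect to `γ` is well-defined as an element of `(-∞, ∞]`:
`f` is measurable with respect to the `γ`-completion of the σ-algebra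
and its negative part is integrable. -/
def HasExtIntegral {α : Type*} [MeasurableSpace α] (γ : Measure α) (f : α → EReal) : Prop :=
  AEMeasurable f γ ∧ ∫⁻ a, (-f a).toENNReal ∂γ ≠ ⊤

/-- `Π(p, q)`: the probability measures on the product space with marginals `p` and `q`. -/
def couplings {α β : Type*} [MeasurableSpace α] [MeasurableSpace β]
    (p : Measure α) (q : Measure β) : Set (ProbabilityMeasure (α × β)) :=
  {γ | (γ : Measure (α × β)).fst = p ∧ (γ : Measure (α × β)).snd = q}

/-! ### Paths, initial segments and the coordinate filtration -/

/-- The first `t` coordinates of a path of length `N`. -/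
def head {N : ℕ} {t : ℕ} (ht : t ≤ N) (x : Fin N → ℝ) : Fin t → ℝ :=
  fun i => x (Fin.castLE ht i)

/-- The last `N - t` coordinates of a path of length `N`. -/
def tail {N : ℕ} (t : ℕ) (x : Fin N → ℝ) : Fin (N - t) → ℝ :=
  fun i => x ⟨t + i, by omega⟩

/-- The history `(x₁, …, xₜ)` prolonged by the value `a` at time `t + 1`. -/
def snocPath {t : ℕ} (x : Fin t → ℝ) (a : ℝ) : Fin (t + 1) → ℝ :=
  Fin.snoc (α := fun _ => ℝ) x a

theorem measurable_head {N t : ℕ} (ht : t ≤ N) : Measurable (head ht) :=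
  measurable_pi_lambda _ fun _ => measurable_pi_apply _

theorem measurable_tail {N : ℕ} (t : ℕ) : Measurable (tail (N := N) t) :=
  measurable_pi_lambda _ fun _ => measurable_pi_apply _

/-- `𝓕ₜ`: the σ-algebra on path space generated by the first `t` coordinates. -/
abbrev pathFiltration {N t : ℕ} (ht : t ≤ N) : MeasurableSpace (Fin N → ℝ) :=
  MeasurableSpace.comap (head ht) inferInstance

/-- The initial segments `(x₁, …, xₜ)` of the points of the support of `μ`. -/
def supportHead {N t : ℕ} (ht : t ≤ N) (μ : Measure (Fin N → ℝ)) : Set (Fin t → ℝ) :=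
  head ht '' μ.support

/-! ### Causal and bicausal transport plans -/

/-- `Π_c(μ, ν)`: the couplings `γ` such that for all `t ∈ {1, …, N}` and `B ∈ 𝓕ₜ` the map
`x ↦ γˣ(B)` is `𝓕ₜ`-measurable modulo a `μ`-null set. -/
def causalPlans {N : ℕ} (μ ν : Measure (Fin N → ℝ)) :
    Set (ProbabilityMeasure ((Fin N → ℝ) × (Fin N → ℝ))) :=
  {γ | γ ∈ couplings μ ν ∧
    ∀ (t : ℕ) (_ : 1 ≤ t) (ht : t ≤ N) (B : Set (Fin N → ℝ)),
      MeasurableSet[pathFiltration ht] B →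
      ∃ g : (Fin N → ℝ) → ENNReal, Measurable[pathFiltration ht] g ∧
        (fun x => (γ : Measure ((Fin N → ℝ) × (Fin N → ℝ))).condKernel x B) =ᵐ[μ] g}

/-- `Π_bc(μ, ν)`: the plans `γ ∈ Π_c(μ, ν)` whose image under `(x, y) ↦ (y, x)` is in
`Π_c(ν, μ)`. -/
def bicausalPlans {N : ℕ} (μ ν : Measure (Fin N → ℝ)) :
    Set (ProbabilityMeasure ((Fin N → ℝ) × (Fin N → ℝ))) :=
  {γ | γ ∈ causalPlans μ ν ∧ γ.map measurable_swap.aemeasurable ∈ causalPlans ν μ}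

/-- The value of the bicausal optimal transport problem. -/
def bicausalValue {N : ℕ} (μ ν : Measure (Fin N → ℝ))
    (c : (Fin N → ℝ) × (Fin N → ℝ) → EReal) : EReal :=
  ⨅ γ ∈ bicausalPlans μ ν, extIntegral (γ : Measure ((Fin N → ℝ) × (Fin N → ℝ))) c

/-! ### Regular conditional kernels -/

/-- A choice, for every `t < N`, of a version of the regular conditional kernel
`μ^{x₁, …, xₜ}(dxₜ₊₁, …, dx_N)` of `μ` with respect to its first `t` coordinates. -/
structure RegularKernels {N : ℕ} (μ : Measure (Fin N → ℝ)) where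
  /-- the kernel `(x₁, …, xₜ) ↦ μ^{x₁, …, xₜ}(dxₜ₊₁, …, dx_N)` -/
  ker : ∀ t : Fin N, Kernel (Fin t → ℝ) (Fin (N - t) → ℝ)
  markov : ∀ t, IsMarkovKernel (ker t)
  disintegrates : ∀ t : Fin N,
    (μ.map (head t.isLt.le)) ⊗ₘ (ker t) = μ.map (fun x => (head t.isLt.le x, tail t x))

theorem RegularKernels.nonempty {N : ℕ} (μ : Measure (Fin N → ℝ)) [IsProbabilityMeasure μ] :
    Nonempty (RegularKernels μ) :=
  ⟨{ ker := fun t => condDistrib (tail t) (head t.isLt.le) μ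
     markov := fun t => inferInstance
     disintegrates := fun t => compProd_map_condDistrib (measurable_tail _).aemeasurable }⟩

/-- The conditional law `μ^{x₁, …, xₜ}` as an element of the space of probability measures,
with its weak topology. -/
def RegularKernels.law {N : ℕ} {μ : Measure (Fin N → ℝ)} (κ : RegularKernels μ) (t : Fin N)
    (x : Fin t → ℝ) : ProbabilityMeasure (Fin (N - t) → ℝ) :=
  ⟨κ.ker t x, (κ.markov t).isProbabilityMeasure x⟩

/-- The one-step conditional law `μ^{x₁, …, xₜ}(dxₜ₊₁)`, the first marginal of
`μ^{x₁, …, xₜ}(dxₜ₊₁, …, dx_N)`. -/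
def RegularKernels.step {N : ℕ} {μ : Measure (Fin N → ℝ)} (κ : RegularKernels μ) (t : Fin N)
    (x : Fin t → ℝ) : Measure ℝ :=
  (κ.ker t x).map (fun z => z ⟨0, Nat.sub_pos_of_lt t.isLt⟩)

/-- The kernels are weakly continuous along the support of `μ`: for each `t < N`, the map
`(x₁, …, xₜ) ↦ μ^{x₁, …, xₜ}(dxₜ₊₁, …, dx_N)` is continuous on the initial segments of points of
`supp μ`. -/
def RegularKernels.WeaklyContinuous {N : ℕ} {μ : Measure (Fin N → ℝ)}
    (κ : RegularKernels μ) : Prop :=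
  ∀ t : Fin N, ContinuousOn (κ.law t) (supportHead t.isLt.le μ)

/-- `μ` is successively weakly continuous. -/
def SuccessivelyWeaklyContinuous {N : ℕ} (μ : Measure (Fin N → ℝ)) : Prop :=
  ∃ κ : RegularKernels μ, κ.WeaklyContinuous

/-! ### The bicausal recursion -/

/-- The nested problem over the last `k` stages, given histories `x, y` of length `t = N - k`:
`inf_{γ ∈ Π(μˣ, νʸ)} ∫ γ(dxₜ₊₁, dyₜ₊₁) inf … ∫ γ(dx_N, dy_N) c`. -/
def nestedValue {N : ℕ} {μ ν : Measure (Fin N → ℝ)} (κ : RegularKernels μ) (η : RegularKernels ν)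
    (c : (Fin N → ℝ) × (Fin N → ℝ) → EReal) :
    (k t : ℕ) → t + k = N → (Fin t → ℝ) → (Fin t → ℝ) → EReal
  | 0, _, h, x, y => c (fun i => x (Fin.cast h.symm i), fun i => y (Fin.cast h.symm i))
  | k + 1, t, h, x, y =>
      ⨅ γ ∈ couplings (κ.step ⟨t, by omega⟩ x) (η.step ⟨t, by omega⟩ y),
        extIntegral (γ : Measure (ℝ × ℝ))
          (fun p => nestedValue κ η c k (t + 1) (by omega) (snocPath x p.1) (snocPath y p.2))

/-- The value of the full nested problem, all `N` stages starting from empty histories. -/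
def dynValue {N : ℕ} {μ ν : Measure (Fin N → ℝ)} (κ : RegularKernels μ) (η : RegularKernels ν)
    (c : (Fin N → ℝ) × (Fin N → ℝ) → EReal) : EReal :=
  nestedValue κ η c N 0 (Nat.zero_add N) Fin.elim0 Fin.elim0

/-- The value function `Vₜ(x₁, …, xₜ, y₁, …, yₜ)`; see `valueFn_last` and `valueFn_of_lt` for the
backward recursion. -/
def valueFn {N : ℕ} {μ ν : Measure (Fin N → ℝ)} (κ : RegularKernels μ) (η : RegularKernels ν)
    (c : (Fin N → ℝ) × (Fin N → ℝ) → EReal) (t : ℕ) (ht : t ≤ N) (x y : Fin t → ℝ) : EReal :=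
  nestedValue κ η c (N - t) t (Nat.add_sub_of_le ht) x y

/-- `V₀ = inf_{γ ∈ Π(p¹_* μ, p¹_* ν)} ∫ V₁(x₁, y₁) γ(dx₁, dy₁)`. -/
def valueZero {N : ℕ} (hN : 1 ≤ N) {μ ν : Measure (Fin N → ℝ)} (κ : RegularKernels μ)
    (η : RegularKernels ν) (c : (Fin N → ℝ) × (Fin N → ℝ) → EReal) : EReal :=
  ⨅ γ ∈ couplings (μ.map (fun x => x ⟨0, hN⟩)) (ν.map (fun y => y ⟨0, hN⟩)),
    extIntegral (γ : Measure (ℝ × ℝ))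
      (fun p => valueFn κ η c 1 hN (fun _ => p.1) (fun _ => p.2))

theorem nestedValue_congr {N : ℕ} {μ ν : Measure (Fin N → ℝ)} (κ : RegularKernels μ)
    (η : RegularKernels ν) (c : (Fin N → ℝ) × (Fin N → ℝ) → EReal) {k k' t : ℕ} (hk : k = k')
    (h : t + k = N) (h' : t + k' = N) (x y : Fin t → ℝ) :
    nestedValue κ η c k t h x y = nestedValue κ η c k' t h' x y := by
  subst hk; rfl

theorem valueFn_last {N : ℕ} {μ ν : Measure (Fin N → ℝ)} (κ : RegularKernels μ)
    (η : RegularKernels ν) (c : (Fin N → ℝ) × (Fin N → ℝ) → EReal) (x y : Fin N → ℝ) :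
    valueFn κ η c N le_rfl x y = c (x, y) :=
  nestedValue_congr κ η c (Nat.sub_self N) _ (Nat.add_zero N) x y

theorem valueFn_of_lt {N : ℕ} {μ ν : Measure (Fin N → ℝ)} (κ : RegularKernels μ)
    (η : RegularKernels ν) (c : (Fin N → ℝ) × (Fin N → ℝ) → EReal) (t : Fin N)
    (x y : Fin t → ℝ) :
    valueFn κ η c t t.isLt.le x y =
      ⨅ γ ∈ couplings (κ.step t x) (η.step t y), extIntegral (γ : Measure (ℝ × ℝ))
        (fun p => valueFn κ η c (t + 1) t.isLt (snocPath x p.1) (snocPath y p.2)) := by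
  have ht := t.isLt
  exact nestedValue_congr κ η c (k' := (N - (t + 1)) + 1) (by omega) _ (by omega) x y

end BicausalOT

end

open BicausalOT

namespace BicausalOT

section

open Set Filter Topology ENNReal

/-! ### Analytic sets are universally measurable -/

/-! A cost bounded from below is `f - b` with `f` valued in `[0, ∞]` and `b` a finite constant.
Integration against probability measures commutes with the shift by `b`, so the whole recursion
reduces to lower Lebesgue integrals (`nestedCost`, `costFn`).

Measurability: the value functions need not be Borel, but they are lower semianalytic, i.e. infima
of jointly Borel functions over a real parameter. Such functions are measurable for every
completion, because projections of Borel sets are analytic and analytic sets are universally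
measurable. The class is stable under one step of the recursion
(`LowerSemianalytic.iInf_lintegral`): by measurable selection the integral of an infimum is the
infimum of integrals over measures lifted to the parameter space, and the space of probability
measures is standard Borel, so it can itself be coded by a real parameter.

Equality of the values: a coupling is bicausal if and only if, given both histories up to `t`, the
next coordinate of each path has the conditional law prescribed by its own history alone
(`mem_bicausalPlans_iff`). Hence the conditional law of the next pair under a bicausal plan is
admissible in the infimum defining `V_t`, which gives `∫ V_t ≤ ∫ V_{t+1}` and finally `V_0 ≤ ∫ c`
(`lintegral_costFn_le`). Conversely, measurably selected nearly optimal one-step couplings glue to a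
bicausal plan of cost at most `V_0 + N ε` (`exists_near_optimal_prefix`).

Semicontinuous case: with weakly continuous kernels, one-step causality is a closed condition on
couplings, so the bicausal plans are compact and the lower semicontinuous cost functional attains
its minimum. Semicontinuity of `V_t` goes by backward induction: couplings of convergent marginals
subconverge, and from a history in the projected support the next step almost surely stays in the
projected support, so values elsewhere never matter. -/

theorem isCompact_setOf_forall_le (k : ℕ → ℕ) : IsCompact {x : ℕ → ℕ | ∀ i, x i ≤ k i} := by
  have := isCompact_univ_pi (s := fun i => Set.Iic (k i)) fun i => (Set.finite_Iic (k i)).isCompact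
  convert this using 1
  ext x; simp [Pi.le_def]

/-- Counterexamples `x n`, truncated by `k`, have a convergent subsequence in the compact box.
Truncation does not change the first `n` coordinates of `x n`, so the untruncated points converge to
the same limit, which lies in the open set `W`. -/
theorem exists_cylinder_subset {k : ℕ → ℕ} {W : Set (ℕ → ℕ)} (hW : IsOpen W)
    (hK : {x : ℕ → ℕ | ∀ i, x i ≤ k i} ⊆ W) :
    ∃ n, {x : ℕ → ℕ | ∀ i < n, x i ≤ k i} ⊆ W := by
  by_contra! hne
  simp only [Set.not_subset] at hne
  choose x hx hxW using hne
  let y : ℕ → ℕ → ℕ := fun n i => min (x n i) (k i)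
  obtain ⟨z, hz, φ, hφ, hlim⟩ := (isCompact_setOf_forall_le k).tendsto_subseq (x := y)
    fun n i => min_le_right _ _
  have hlim' : Tendsto (fun n => x (φ n)) atTop (𝓝 z) := by
    rw [tendsto_pi_nhds] at hlim ⊢
    intro i
    refine (hlim i).congr' ?_
    filter_upwards [eventually_gt_atTop i] with n hn
    exact min_eq_left (hx _ i (hn.trans_le hφ.le_apply))
  obtain ⟨n, hn⟩ := (hlim'.eventually (hW.mem_nhds (hK hz))).exists
  exact hxW _ hn

/-- Capacitability: bounds on the coordinates of Baire space are chosen one at a time so that the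
image keeps outer measure above `r`. Any open set around the image of the resulting compact box
contains the image of one of these cylinders, and outer regularity transfers the bound to the box.
-/
theorem exists_isCompact_subset_lt_measure_of_range {X : Type*} [TopologicalSpace X]
    [MeasurableSpace X] (π : Measure X) [π.OuterRegular]
    {f : (ℕ → ℕ) → X} (hf : Continuous f) {r : ℝ≥0∞} (hr : r < π (range f)) :
    ∃ K ⊆ range f, IsCompact K ∧ r ≤ π K := by
  have step : ∀ (n : ℕ) (S : Set (ℕ → ℕ)), r < π (f '' S) →
      ∃ m, r < π (f '' (S ∩ {x | x n ≤ m})) := by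
    intro n S hS
    have hmono : Monotone fun m : ℕ => f '' (S ∩ {x | x n ≤ m}) := by
      intro a b hab
      exact image_mono (inter_subset_inter_right _ fun x (hx : x n ≤ a) => hx.trans hab)
    have hU : f '' S = ⋃ m, f '' (S ∩ {x | x n ≤ m}) := by
      rw [← image_iUnion, ← inter_iUnion]
      congr 1
      refine (inter_eq_left.2 fun x _ => mem_iUnion.2 ⟨x n, ?_⟩).symm
      simp
    -- Continuity from below holds for increasing sequences of arbitrary sets, so the measurability
    -- of these images is not needed.
    rw [hU, hmono.measure_iUnion, lt_iSup_iff] at hS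
    exact hS
  choose! m hm using step
  let S : ℕ → Set (ℕ → ℕ) := fun n => Nat.rec univ (fun n S => S ∩ {x | x n ≤ m n S}) n
  have hSsucc : ∀ n, S (n + 1) = S n ∩ {x | x n ≤ m n (S n)} := fun n => rfl
  have hS : ∀ n, r < π (f '' S n) := by
    intro n
    induction n with
    | zero => simpa [S] using hr
    | succ n ih => rw [hSsucc]; exact hm n _ ih
  let k : ℕ → ℕ := fun n => m n (S n)
  have hSk : ∀ n, S n = {x | ∀ i < n, x i ≤ k i} := by
    intro n
    induction n with
    | zero => simp [S]
    | succ n ih =>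
      rw [hSsucc]
      ext x
      simp only [mem_inter_iff, mem_ofPred_eq, Nat.forall_lt_succ_right]
      conv_lhs => rw [show (x ∈ S n) = (x ∈ {x : ℕ → ℕ | ∀ i < n, x i ≤ k i}) by rw [← ih]]
      rfl
  refine ⟨f '' {x | ∀ i, x i ≤ k i}, image_subset_range _ _,
    (isCompact_setOf_forall_le k).image hf, ?_⟩
  refine le_of_forall_gt fun a ha => ?_
  obtain ⟨U, hU, hUo, hUa⟩ := Set.exists_isOpen_lt_of_lt _ _ ha
  obtain ⟨n, hn⟩ := exists_cylinder_subset (hUo.preimage hf) (image_subset_iff.1 hU)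
  calc r < π (f '' S n) := hS n
    _ ≤ π U := measure_mono (image_subset_iff.2 (hSk n ▸ hn))
    _ < a := hUa

/-- The set lies between a countable union of compact sets and its measurable hull, which have the
same finite measure. -/
theorem nullMeasurableSet_of_analyticSet {X : Type*} [TopologicalSpace X] [T2Space X]
    [MeasurableSpace X] [OpensMeasurableSpace X] {A : Set X} (hA : AnalyticSet A)
    (π : Measure X) [IsFiniteMeasure π] [π.OuterRegular] : NullMeasurableSet A π := by
  rw [AnalyticSet] at hA
  rcases hA with rfl | ⟨f, hf, rfl⟩
  · exact MeasurableSet.empty.nullMeasurableSet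
  have key : ∀ r < π (range f), ∃ K ⊆ range f, MeasurableSet K ∧ r ≤ π K := fun r hr => by
    obtain ⟨K, h1, h2, h3⟩ := exists_isCompact_subset_lt_measure_of_range π hf hr
    exact ⟨K, h1, h2.measurableSet, h3⟩
  rcases eq_or_ne (π (range f)) 0 with h0 | h0
  · exact NullMeasurableSet.of_null h0
  obtain ⟨u, -, hu, hulim⟩ := exists_seq_strictMono_tendsto' (pos_iff_ne_zero.2 h0)
  choose K hK hKm hKr using fun n => key (u n) (hu n).2
  have hsub : (⋃ n, K n) ⊆ range f := iUnion_subset hK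
  have hge : π (range f) ≤ π (⋃ n, K n) :=
    le_of_tendsto' hulim fun n => (hKr n).trans (measure_mono (subset_iUnion K n))
  have hT := subset_toMeasurable π (range f)
  have hUm : MeasurableSet (⋃ n, K n) := MeasurableSet.iUnion hKm
  have : (⋃ n, K n) =ᵐ[π] toMeasurable π (range f) :=
    ae_eq_of_subset_of_measure_ge (hsub.trans hT) (by rw [measure_toMeasurable]; exact hge)
      hUm.nullMeasurableSet (measure_ne_top _ _)
  refine hUm.nullMeasurableSet.congr ?_
  exact (LE.le.eventuallyLE hsub).antisymm
    ((LE.le.eventuallyLE hT).trans this.symm.le)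

theorem nullMeasurableSet_fst_image {X W : Type*} [MeasurableSpace X] [StandardBorelSpace X]
    [MeasurableSpace W] [StandardBorelSpace W] {G : Set (X × W)} (hG : MeasurableSet G)
    (π : Measure X) [IsFiniteMeasure π] : NullMeasurableSet (Prod.fst '' G) π := by
  let := upgradeStandardBorel X
  let := upgradeStandardBorel W
  exact nullMeasurableSet_of_analyticSet (hG.analyticSet.image_of_continuous continuous_fst) π

/-! ### Measurable selection modulo null sets -/

/-- The sequences whose initial segment, read backwards, is the given list. -/
def seqCylinder : List ℕ → Set (ℕ → ℕ)
  | [] => univ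
  | m :: l => {z | z l.length = m} ∩ seqCylinder l

theorem measurableSet_seqCylinder (l : List ℕ) : MeasurableSet (seqCylinder l) := by
  induction l with
  | nil => exact MeasurableSet.univ
  | cons m l ih =>
    exact ((measurable_pi_apply l.length) (measurableSet_singleton m)).inter ih

/-- The branch of least elements through the nonempty members of a family of sets indexed by
finite sequences. -/
noncomputable def leastBranch {X : Type*} (A : List ℕ → Set X) : ℕ → X → List ℕ
  | 0, _ => []
  | k + 1, x => sInf {m | x ∈ A (m :: leastBranch A k x)} :: leastBranch A k x

theorem length_leastBranch {X : Type*} (A : List ℕ → Set X) (k : ℕ) (x : X) :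
    (leastBranch A k x).length = k := by
  induction k with
  | zero => rfl
  | succ k ih => simp [leastBranch, ih]

theorem measurable_leastBranch {X : Type*} [MeasurableSpace X] {A : List ℕ → Set X}
    (hA : ∀ l, MeasurableSet (A l)) (k : ℕ) (l : List ℕ) :
    MeasurableSet {x | leastBranch A k x = l} := by
  induction k generalizing l with
  | zero => exact MeasurableSet.const ([] = l)
  | succ k ih =>
    rcases l with _ | ⟨m, l⟩
    · simp [leastBranch]
    have : {x | leastBranch A (k + 1) x = m :: l}
        = {x | sInf {m | x ∈ A (m :: l)} = m} ∩ {x | leastBranch A k x = l} := by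
      ext x
      simp only [leastBranch, List.cons.injEq, mem_ofPred_eq, mem_inter_iff]
      constructor
      · rintro ⟨h1, h2⟩; rw [h2] at h1; exact ⟨h1, h2⟩
      · rintro ⟨h1, h2⟩; rw [h2]; exact ⟨h1, rfl⟩
    rw [this]
    refine MeasurableSet.inter ?_ (ih l)
    -- In `ℕ` the infimum of the empty set is `0`; this accounts for the second set of the union.
    have h2 : {x | sInf {m | x ∈ A (m :: l)} = m}
        = (A (m :: l) ∩ ⋂ j, ⋂ (_ : j < m), (A (j :: l))ᶜ) ∪
          ({_x | m = 0} ∩ ⋂ j, (A (j :: l))ᶜ) := by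
      ext x
      simp only [mem_ofPred_eq, mem_union, mem_inter_iff, mem_iInter, mem_compl_iff]
      constructor
      · rintro rfl
        rcases eq_empty_or_nonempty {m | x ∈ A (m :: l)} with h | h
        · right
          refine ⟨by rw [h]; simp, fun j hj => ?_⟩
          have : j ∈ {m | x ∈ A (m :: l)} := hj
          rw [h] at this; exact this
        · left
          exact ⟨Nat.sInf_mem h, fun j hj hjA => (Nat.sInf_le hjA).not_gt hj⟩
      · rintro (⟨h1, h2⟩ | ⟨h1, h2⟩)
        · refine le_antisymm (Nat.sInf_le h1) ?_
          by_contra hlt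
          exact h2 _ (not_le.1 hlt) (Nat.sInf_mem (s := {m | x ∈ A (m :: l)}) ⟨m, h1⟩)
        · have : {m | x ∈ A (m :: l)} = ∅ := by
            ext j; simpa using h2 j
          rw [this, h1]; simp
    rw [h2]
    exact ((hA _).inter (MeasurableSet.iInter fun j => MeasurableSet.iInter fun _ =>
      (hA _).compl)).union ((MeasurableSet.const _).inter (MeasurableSet.iInter fun j =>
        (hA _).compl))

theorem aemeasurable_of_nullMeasurableSet_fiber {X : Type*} [MeasurableSpace X] {π : Measure X}
    {a : X → ℕ} (ha : ∀ m, NullMeasurableSet {x | a x = m} π) : AEMeasurable a π := by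
  have h : NullMeasurable a π := by
    intro s _
    have : a ⁻¹' s = ⋃ m ∈ s, {x | a x = m} := by ext x; simp
    rw [this]
    exact NullMeasurableSet.biUnion (to_countable s) fun m _ => ha m
  exact h.aemeasurable

/-- **Measurable selection**: a measurable set with almost all sections nonempty contains, up to a
null set, the graph of a measurable function. -/
theorem exists_measurable_selection {X W : Type*} [MeasurableSpace X] [StandardBorelSpace X]
    [MeasurableSpace W] [StandardBorelSpace W] [Nonempty W] (π : Measure X) [IsFiniteMeasure π]
    {G : Set (X × W)} (hG : MeasurableSet G) (hne : ∀ᵐ x ∂π, ∃ w, (x, w) ∈ G) :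
    ∃ s : X → W, Measurable s ∧ ∀ᵐ x ∂π, (x, s x) ∈ G := by
  let := upgradeStandardBorel X
  let := upgradeStandardBorel W
  have hGa := hG.analyticSet
  rw [AnalyticSet] at hGa
  rcases hGa with rfl | ⟨f, hf, hfG⟩
  · exact ⟨fun _ => Classical.arbitrary W, measurable_const, hne.mono fun x ⟨w, hw⟩ => hw.elim⟩
  -- Jankov–von Neumann uniformisation: `G` is the image of Baire space under `f`, and above each
  -- `x` the lexicographically least code is chosen. `A l` consists of the points with a code in the
  -- cylinder of `l`; it is analytic, hence null measurable.
  let A : List ℕ → Set X := fun l => (fun z => (f z).1) '' seqCylinder l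
  have hA : ∀ l, NullMeasurableSet (A l) π := fun l =>
    nullMeasurableSet_of_analyticSet
      ((measurableSet_seqCylinder l).analyticSet.image_of_continuous (by fun_prop)) π
  let b : X → ℕ → ℕ := fun x k => sInf {m | x ∈ A (m :: leastBranch A k x)}
  have hL : ∀ k l, NullMeasurableSet {x | leastBranch A k x = l} π := fun k l =>
    -- The lemma is used for the σ-algebra of `π`-null measurable sets.
    measurable_leastBranch (X := NullMeasurableSpace X π) hA k l
  have hb : AEMeasurable b π := by
    refine aemeasurable_pi_lambda _ fun k => aemeasurable_of_nullMeasurableSet_fiber fun m => ?_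
    have : {x | b x k = m} = ⋃ l, {x | leastBranch A (k + 1) x = m :: l} := by
      ext x
      simp [leastBranch, b]
    rw [this]
    exact NullMeasurableSet.iUnion fun l => hL _ _
  have hs : AEMeasurable (fun x => (f (b x)).2) π :=
    (continuous_snd.comp hf).measurable.comp_aemeasurable hb
  refine ⟨hs.mk _, hs.measurable_mk, ?_⟩
  filter_upwards [hne, hs.ae_eq_mk] with x ⟨w, hw⟩ hx
  rw [← hx]
  have hmem : ∀ k, x ∈ A (leastBranch A k x) := by
    intro k
    induction k with
    | zero =>
      rw [← hfG] at hw
      obtain ⟨z, hz⟩ := hw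
      exact ⟨z, mem_univ _, by simp [hz]⟩
    | succ k ih =>
      obtain ⟨z, hz, hzx⟩ := ih
      refine Nat.sInf_mem (s := {m | x ∈ A (m :: leastBranch A k x)})
        ⟨z (leastBranch A k x).length, z, ⟨rfl, hz⟩, hzx⟩
  have hcyl : ∀ k z, z ∈ seqCylinder (leastBranch A k x) → ∀ i < k, z i = b x i := by
    intro k
    induction k with
    | zero => intro z _ i hi; omega
    | succ k ih =>
      rintro z ⟨hz1, hz2⟩ i hi
      rcases Nat.lt_succ_iff_lt_or_eq.1 hi with h | rfl
      · exact ih z hz2 i h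
      · rw [length_leastBranch] at hz1; exact hz1
  choose z hz hzx using hmem
  -- `z k` is a code of a point above `x` that agrees with `b x` in the first `k` places; by
  -- continuity `b x` also codes a point above `x`.
  have hlim : Tendsto z atTop (𝓝 (b x)) := by
    rw [tendsto_pi_nhds]
    intro i
    refine tendsto_const_nhds.congr' ?_
    filter_upwards [eventually_gt_atTop i] with k hk
    exact (hcyl k _ (hz k) i hk).symm
  have h1 : (f (b x)).1 = x := by
    refine tendsto_nhds_unique ((continuous_fst.comp hf).continuousAt.tendsto.comp hlim) ?_
    refine tendsto_const_nhds.congr fun k => ?_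
    exact (hzx k).symm
  rw [← hfG]
  exact ⟨b x, Prod.ext h1 rfl⟩

/-! ### Lower semicontinuity of integrals in the weak topology -/

theorem lowerSemicontinuous_measure_of_isOpen {X : Type*} [TopologicalSpace X] [MeasurableSpace X]
    [OpensMeasurableSpace X] [HasOuterApproxClosed X] {U : Set X} (hU : IsOpen U) :
    LowerSemicontinuous fun γ : ProbabilityMeasure X => (γ : Measure X) U := by
  intro γ a ha
  have h := ProbabilityMeasure.le_liminf_measure_open_of_tendsto (tendsto_id (x := 𝓝 γ)) hU
  exact eventually_lt_of_lt_liminf (ha.trans_le h)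

/-- Layer-cake formula plus Fatou: the superlevel sets of `f` are open. Truncation at `m` makes the
function finite, as the real-valued layer-cake formula requires. -/
theorem lintegral_le_liminf_of_lowerSemicontinuous {X : Type*} [TopologicalSpace X]
    [MeasurableSpace X] [OpensMeasurableSpace X] {γ : Measure X}
    {γs : ℕ → Measure X} {f : X → ℝ≥0∞} (hf : LowerSemicontinuous f)
    (h : ∀ G, IsOpen G → γ G ≤ atTop.liminf fun n => γs n G) :
    ∫⁻ x, f x ∂γ ≤ atTop.liminf fun n => ∫⁻ x, f x ∂(γs n) := by
  have hfm : Measurable f := hf.measurable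
  have htrunc : ∀ m : ℕ, ∫⁻ x, min (f x) m ∂γ ≤ atTop.liminf fun n => ∫⁻ x, f x ∂(γs n) := by
    intro m
    have hfin : ∀ x, min (f x) (m : ℝ≥0∞) ≠ ⊤ := fun x =>
      ne_top_of_le_ne_top (natCast_ne_top m) (min_le_right _ _)
    have hlc : ∀ ρ : Measure X, ∫⁻ x, min (f x) m ∂ρ
        = ∫⁻ t in Ioi (0 : ℝ), ρ {x | t < (min (f x) (m : ℝ≥0∞)).toReal} := by
      intro ρ
      rw [← lintegral_eq_lintegral_meas_lt ρ (Eventually.of_forall fun x => toReal_nonneg)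
        (hfm.min measurable_const).ennreal_toReal.aemeasurable]
      exact lintegral_congr fun x => (ofReal_toReal (hfin x)).symm
    have hopen : ∀ t : ℝ, 0 < t → IsOpen {x | t < (min (f x) (m : ℝ≥0∞)).toReal} := by
      intro t ht
      have : {x | t < (min (f x) (m : ℝ≥0∞)).toReal}
          = {x | ENNReal.ofReal t < f x} ∩ {_x | ENNReal.ofReal t < m} := by
        ext x
        simp only [mem_ofPred_eq, mem_inter_iff,
          ← ofReal_lt_iff_lt_toReal ht.le (hfin x), lt_min_iff]
      rw [this]
      exact (hf.isOpen_preimage _).inter isOpen_const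
    calc ∫⁻ x, min (f x) m ∂γ
        ≤ ∫⁻ t in Ioi (0 : ℝ), atTop.liminf fun n =>
            γs n {x | t < (min (f x) (m : ℝ≥0∞)).toReal} := by
          rw [hlc]
          exact setLIntegral_mono' measurableSet_Ioi fun t ht => h _ (hopen t ht)
      _ ≤ atTop.liminf fun n => ∫⁻ t in Ioi (0 : ℝ),
            γs n {x | t < (min (f x) (m : ℝ≥0∞)).toReal} :=
          lintegral_liminf_le fun n => Antitone.measurable fun s t hst =>
            measure_mono fun x hx => lt_of_le_of_lt hst hx
      _ ≤ atTop.liminf fun n => ∫⁻ x, f x ∂(γs n) := by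
          simp_rw [← hlc]
          exact liminf_le_liminf (Eventually.of_forall fun n =>
            lintegral_mono fun x => min_le_left _ _)
  have hsup : ∫⁻ x, f x ∂γ = ⨆ m : ℕ, ∫⁻ x, min (f x) m ∂γ := by
    rw [← lintegral_iSup (fun m => hfm.min measurable_const) fun a b hab x =>
      min_le_min_left _ (Nat.cast_le.2 hab)]
    refine lintegral_congr fun x => ?_
    rw [← inf_iSup_eq, iSup_natCast, inf_top_eq]
  rw [hsup]
  exact iSup_le htrunc

/-! ### The space of probability measures is standard Borel -/

theorem ProbabilityMeasure.measurable_of_measurable_coe {X Y : Type*} [MeasurableSpace X]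
    [MeasurableSpace Y] {f : X → ProbabilityMeasure Y}
    (hf : Measurable fun x => (f x : Measure Y)) : Measurable f :=
  hf.subtype_mk

theorem ProbabilityMeasure.measurable_coe {Y : Type*} [MeasurableSpace Y] :
    Measurable fun γ : ProbabilityMeasure Y => (γ : Measure Y) :=
  measurable_subtype_coe

theorem measurable_coe_of_opensMeasurableSpace {E : Type*} [TopologicalSpace E] [MeasurableSpace E]
    [BorelSpace E] [HasOuterApproxClosed E] :
    @Measurable _ _ (borel (ProbabilityMeasure E)) _
      (fun γ : ProbabilityMeasure E => (γ : Measure E)) := by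
  let m : MeasurableSpace (ProbabilityMeasure E) := borel _
  have : BorelSpace (ProbabilityMeasure E) := ⟨rfl⟩
  refine Measurable.measure_of_isPiSystem_of_isProbabilityMeasure
    (BorelSpace.measurable_eq.trans rfl) isPiSystem_isOpen
    fun U hU => ?_
  exact (lowerSemicontinuous_measure_of_isOpen hU).measurable

/-- A probability measure is determined by its values on a countable generating algebra, and each
value by countably many sets of `ℝ≥0∞`. -/
theorem countablySeparated_probabilityMeasure {E : Type*} [MeasurableSpace E]
    [MeasurableSpace.CountablyGenerated E] :
    MeasurableSpace.CountablySeparated (ProbabilityMeasure E) := by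
  obtain ⟨b, hb, hgen⟩ :=
    (inferInstance : MeasurableSpace.CountablyGenerated E).isCountablyGenerated
  obtain ⟨T, hT, hTm, hTs⟩ :=
    (inferInstance : MeasurableSpace.CountablySeparated ℝ≥0∞).countably_separated
  have hA : IsSetAlgebra (generateSetAlgebra b) := isSetAlgebra_generateSetAlgebra
  have hAgen : ‹MeasurableSpace E› = MeasurableSpace.generateFrom (generateSetAlgebra b) := by
    rw [generateFrom_generateSetAlgebra_eq, hgen]
  have hm : ∀ s ∈ generateSetAlgebra b, MeasurableSet s := fun s hs => by
    rw [hAgen]; exact MeasurableSpace.measurableSet_generateFrom hs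
  refine ⟨⟨image2 (fun s t => {γ : ProbabilityMeasure E | (γ : Measure E) s ∈ t})
    (generateSetAlgebra b) T, (countable_generateSetAlgebra hb).image2 hT _, ?_, ?_⟩⟩
  · rintro _ ⟨s, hs, t, ht, rfl⟩
    exact ((Measure.measurable_coe (hm s hs)).comp ProbabilityMeasure.measurable_coe) (hTm t ht)
  · intro γ _ γ' _ h
    apply ProbabilityMeasure.toMeasure_injective
    refine ext_of_generate_finite _ hAgen hA.isSetRing.isSetSemiring.isPiSystem (fun s hs => ?_)
      (by simp)
    exact hTs _ (mem_univ _) _ (mem_univ _) fun t ht => h _ ⟨s, hs, t, ht, rfl⟩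

/-- The weak topology is compact and metrizable, hence Polish. Its Borel σ-algebra contains the one
generated by evaluations; as the latter is countably separated, the Lusin–Souslin theorem forces
equality. -/
theorem standardBorelSpace_probabilityMeasure_of_compactSpace (E : Type*) [TopologicalSpace E]
    [CompactSpace E] [TopologicalSpace.MetrizableSpace E] [MeasurableSpace E] [BorelSpace E] :
    StandardBorelSpace (ProbabilityMeasure E) := by
  have : SecondCountableTopology E := by
    let := TopologicalSpace.metrizableSpaceMetric E
    infer_instance
  let := TopologicalSpace.metrizableSpaceMetric (ProbabilityMeasure E)
  have hsep : MeasurableSpace.CountablySeparated (ProbabilityMeasure E) :=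
    countablySeparated_probabilityMeasure
  have hle : @Measurable _ _ (borel (ProbabilityMeasure E)) inferInstance
      (id : ProbabilityMeasure E → ProbabilityMeasure E) := by
    let m : MeasurableSpace (ProbabilityMeasure E) := borel _
    exact ProbabilityMeasure.measurable_of_measurable_coe measurable_coe_of_opensMeasurableSpace
  have hborel : (inferInstance : MeasurableSpace (ProbabilityMeasure E)) = borel _ := by
    have := @Measurable.map_measurableSpace_eq _ _ (borel (ProbabilityMeasure E))
      (@standardBorel_of_polish _ (borel _) _ (@BorelSpace.mk _ _ (borel _) rfl) inferInstance)
      _ hsep id hle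
      Function.surjective_id
    rw [← this, MeasurableSpace.map_id]
  have : BorelSpace (ProbabilityMeasure E) := ⟨hborel⟩
  infer_instance

theorem standardBorelSpace_of_measurableEmbedding {α β : Type*} [MeasurableSpace α]
    [MeasurableSpace β] [StandardBorelSpace β] {f : α → β} (hf : MeasurableEmbedding f) :
    StandardBorelSpace α := by
  have := hf.measurableSet_range.standardBorel
  let := upgradeStandardBorel (range f)
  let e := hf.equivRange
  let τ : TopologicalSpace α := TopologicalSpace.induced e inferInstance
  refine ⟨τ, ⟨?_⟩, e.toEquiv.polishSpace_induced⟩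
  rw [borel_comap, ← BorelSpace.measurable_eq (α := range f)]
  exact e.measurableEmbedding.comap_eq.symm

/-- `α` embeds measurably into the compact space `EReal`, with a measurable left inverse `r`.
Push-forward identifies the laws on `α` with the measurable set of laws on `EReal` carried by the
range of the embedding. -/
instance standardBorelSpace_probabilityMeasure {α : Type*} [MeasurableSpace α]
    [StandardBorelSpace α] : StandardBorelSpace (ProbabilityMeasure α) := by
  rcases isEmpty_or_nonempty α with h | h
  · have : IsEmpty (ProbabilityMeasure α) := ⟨fun γ => (γ.nonempty).elim h.elim⟩
    infer_instance
  have hS := standardBorelSpace_probabilityMeasure_of_compactSpace EReal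
  have he : MeasurableEmbedding fun a : α => ((embeddingReal α a : ℝ) : EReal) :=
    EReal.isOpenEmbedding_coe.measurableEmbedding.comp (measurableEmbedding_embeddingReal α)
  obtain ⟨r, hr, hre⟩ := he.exists_measurable_extend measurable_id fun _ => h
  set e := fun a : α => ((embeddingReal α a : ℝ) : EReal)
  let F : ProbabilityMeasure α → ProbabilityMeasure EReal := fun γ =>
    γ.map he.measurable.aemeasurable
  let G : ProbabilityMeasure EReal → ProbabilityMeasure α := fun γ => γ.map hr.aemeasurable
  have hF : Measurable F := ProbabilityMeasure.measurable_of_measurable_coe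
    ((Measure.measurable_map _ he.measurable).comp ProbabilityMeasure.measurable_coe)
  have hG : Measurable G := ProbabilityMeasure.measurable_of_measurable_coe
    ((Measure.measurable_map _ hr).comp ProbabilityMeasure.measurable_coe)
  have hGF : Function.LeftInverse G F := by
    intro γ
    apply Subtype.ext
    change (Measure.map e γ).map r = _
    rw [Measure.map_map hr he.measurable, hre, Measure.map_id]
    rfl
  have hrange : range F = {γ : ProbabilityMeasure EReal | (γ : Measure EReal) (range e)ᶜ = 0} := by
    ext γ
    constructor
    · rintro ⟨γ, rfl⟩
      change (Measure.map e γ) (range e)ᶜ = 0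
      rw [Measure.map_apply he.measurable he.measurableSet_range.compl]
      simp
    · intro hγ
      refine ⟨G γ, ?_⟩
      apply Subtype.ext
      change (Measure.map r γ).map e = γ
      rw [Measure.map_map he.measurable hr]
      have : e ∘ r =ᵐ[(γ : Measure EReal)] id := by
        filter_upwards [compl_mem_ae_iff.2 hγ] with z hz
        rw [compl_compl] at hz
        obtain ⟨a, rfl⟩ := hz
        exact congrArg e (congrFun hre a)
      rw [Measure.map_congr this, Measure.map_id]
  have hm : MeasurableSet (range F) := by
    rw [hrange]
    exact ((Measure.measurable_coe he.measurableSet_range.compl).comp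
      ProbabilityMeasure.measurable_coe) (measurableSet_singleton 0)
  exact standardBorelSpace_of_measurableEmbedding
    (MeasurableEmbedding.of_measurable_inverse hF hm hG hGF)

/-! ### Lower semianalytic functions -/

/-- Lower semianalytic functions: the infima over a real parameter of jointly measurable
functions. -/
def LowerSemianalytic {X : Type*} [MeasurableSpace X] (f : X → ℝ≥0∞) : Prop :=
  ∃ g : X × ℝ → ℝ≥0∞, Measurable g ∧ ∀ x, f x = ⨅ w, g (x, w)

/-- A standard Borel parameter space embeds in `ℝ`, and the extension by `⊤` off the image does not
affect the infimum. -/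
theorem lowerSemianalytic_iInf {X W : Type*} [MeasurableSpace X] [MeasurableSpace W]
    [StandardBorelSpace W] {g : X × W → ℝ≥0∞} (hg : Measurable g) :
    LowerSemianalytic fun x => ⨅ w, g (x, w) := by
  have he : MeasurableEmbedding (Prod.map id (embeddingReal W) : X × W → X × ℝ) :=
    MeasurableEmbedding.id.prodMap (measurableEmbedding_embeddingReal W)
  have hinj := (measurableEmbedding_embeddingReal W).injective
  refine ⟨Function.extend (Prod.map id (embeddingReal W)) g fun _ => ⊤,
    he.measurable_extend hg measurable_const, fun x => le_antisymm ?_ ?_⟩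
  · refine le_iInf fun r => ?_
    by_cases h : ∃ p : X × W, Prod.map id (embeddingReal W) p = (x, r)
    · obtain ⟨⟨x', w⟩, hp⟩ := h
      rw [← hp, he.injective.extend_apply]
      obtain rfl : x' = x := congrArg Prod.fst hp
      exact iInf_le _ w
    · rw [Function.extend_apply' _ _ _ h]
      exact le_top
  · refine le_iInf fun w => (iInf_le _ (embeddingReal W w)).trans_eq ?_
    exact he.injective.extend_apply g _ (x, w)

theorem Measurable.lowerSemianalytic {X : Type*} [MeasurableSpace X] {f : X → ℝ≥0∞}
    (hf : Measurable f) : LowerSemianalytic f :=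
  ⟨fun p => f p.1, hf.comp measurable_fst, fun _ => by simp⟩

theorem LowerSemianalytic.comp {X Y : Type*} [MeasurableSpace X] [MeasurableSpace Y]
    {f : Y → ℝ≥0∞} (hf : LowerSemianalytic f) {φ : X → Y} (hφ : Measurable φ) :
    LowerSemianalytic fun x => f (φ x) := by
  obtain ⟨g, hg, hfg⟩ := hf
  exact ⟨fun p => g (φ p.1, p.2), hg.comp (by fun_prop), fun x => hfg _⟩

/-- A strict sublevel set of an infimum is the projection of a Borel sublevel set, hence analytic.
-/
theorem LowerSemianalytic.aemeasurable {X : Type*} [MeasurableSpace X] [StandardBorelSpace X]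
    {f : X → ℝ≥0∞} (hf : LowerSemianalytic f) (π : Measure X) [IsFiniteMeasure π] :
    AEMeasurable f π := by
  obtain ⟨g, hg, hfg⟩ := hf
  have hlt : ∀ a, NullMeasurableSet (f ⁻¹' Iio a) π := by
    intro a
    have : f ⁻¹' Iio a = Prod.fst '' {p | g p < a} := by
      ext x
      simp [hfg, iInf_lt_iff]
    rw [this]
    exact nullMeasurableSet_fst_image (measurableSet_lt hg measurable_const) π
  have h : NullMeasurable f π :=
    measurable_of_Iio (δ := NullMeasurableSpace X π) hlt
  exact h.aemeasurable

theorem measurable_probabilityMeasure_fst {U W : Type*} [MeasurableSpace U] [MeasurableSpace W] :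
    Measurable fun Γ : ProbabilityMeasure (U × W) => Γ.map measurable_fst.aemeasurable :=
  ProbabilityMeasure.measurable_of_measurable_coe
    ((Measure.measurable_map _ measurable_fst).comp ProbabilityMeasure.measurable_coe)

theorem measurable_probabilityMeasure_snd {U W : Type*} [MeasurableSpace U] [MeasurableSpace W] :
    Measurable fun Γ : ProbabilityMeasure (U × W) => Γ.map measurable_snd.aemeasurable :=
  ProbabilityMeasure.measurable_of_measurable_coe
    ((Measure.measurable_map _ measurable_snd).comp ProbabilityMeasure.measurable_coe)

theorem measurable_lintegral_probabilityMeasure {X U : Type*} [MeasurableSpace X]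
    [MeasurableSpace U] {g : X × U → ℝ≥0∞} (hg : Measurable g) :
    Measurable fun p : X × ProbabilityMeasure U => ∫⁻ u, g (p.1, u) ∂(p.2 : Measure U) := by
  let κ : Kernel (X × ProbabilityMeasure U) U :=
    ⟨fun p => p.2, ProbabilityMeasure.measurable_coe.comp measurable_snd⟩
  have : IsMarkovKernel κ := ⟨fun p => inferInstanceAs (IsProbabilityMeasure (p.2 : Measure U))⟩
  exact Measurable.lintegral_kernel_prod_right' (κ := κ)
    (f := fun q : (X × ProbabilityMeasure U) × U => g (q.1.1, q.2)) (hg.comp (by fun_prop))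

/-! ### Interchange of infima and integrals -/

section Projection

variable {X U : Type*} [MeasurableSpace X] [MeasurableSpace U] [StandardBorelSpace U]
  {g : (X × U) × ℝ → ℝ≥0∞}

/-- A measurable near-minimiser `s` carries `γ` to the graph measure of `u ↦ (u, s u)`. The infimum
is replaced by its Borel version `hf.mk`, so that the set to select from is Borel. -/
theorem exists_lift_lintegral_le (hg : Measurable g) (x : X) (γ : ProbabilityMeasure U)
    {ε : ℝ≥0∞} (hε : ε ≠ 0) :
    ∃ Γ : ProbabilityMeasure (U × ℝ), Γ.map measurable_fst.aemeasurable = γ ∧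
      ∫⁻ p, g ((x, p.1), p.2) ∂(Γ : Measure (U × ℝ))
        ≤ ∫⁻ u, ⨅ w, g ((x, u), w) ∂(γ : Measure U) + ε := by
  have hf : AEMeasurable (fun u => ⨅ w, g ((x, u), w)) (γ : Measure U) :=
    LowerSemianalytic.aemeasurable ⟨fun p => g ((x, p.1), p.2), hg.comp (by fun_prop),
      fun _ => rfl⟩ _
  have hG : MeasurableSet {p : U × ℝ | g ((x, p.1), p.2) ≤ hf.mk _ p.1 + ε} :=
    measurableSet_le (hg.comp (by fun_prop)) ((hf.measurable_mk.comp measurable_fst).add_const _)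
  obtain ⟨s, hs, hsG⟩ := exists_measurable_selection (γ : Measure U) hG (by
    filter_upwards [hf.ae_eq_mk] with u hu
    simp only [← hu]
    by_cases htop : ⨅ w, g ((x, u), w) = ⊤
    · exact ⟨0, by simp [htop]⟩
    · obtain ⟨w, hw⟩ := iInf_lt_iff.1 (ENNReal.lt_add_right htop hε)
      exact ⟨w, hw.le⟩)
  have hm : Measurable fun u => (u, s u) := measurable_id.prodMk hs
  refine ⟨γ.map hm.aemeasurable, ?_, ?_⟩
  · apply ProbabilityMeasure.toMeasure_injective
    simp only [ProbabilityMeasure.toMeasure_map]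
    rw [Measure.map_map measurable_fst hm]
    exact Measure.map_id
  · rw [ProbabilityMeasure.toMeasure_map,
      lintegral_map (f := fun p : U × ℝ => g ((x, p.1), p.2)) (hg.comp (by fun_prop)) hm]
    calc ∫⁻ u, g ((x, u), s u) ∂(γ : Measure U)
        ≤ ∫⁻ u, (⨅ w, g ((x, u), w)) + ε ∂(γ : Measure U) := by
          refine lintegral_mono_ae ?_
          filter_upwards [hsG, hf.ae_eq_mk] with u h1 h2
          rw [h2]; exact h1
      _ = _ := by rw [lintegral_add_right _ measurable_const]; simp

theorem lintegral_iInf_le_lift (hg : Measurable g) (x : X) (Γ : ProbabilityMeasure (U × ℝ)) :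
    ∫⁻ u, ⨅ w, g ((x, u), w) ∂(Γ.map measurable_fst.aemeasurable : Measure U)
      ≤ ∫⁻ p, g ((x, p.1), p.2) ∂(Γ : Measure (U × ℝ)) := by
  have hf : AEMeasurable (fun u => ⨅ w, g ((x, u), w))
      (Γ.map measurable_fst.aemeasurable : Measure U) :=
    LowerSemianalytic.aemeasurable ⟨fun p => g ((x, p.1), p.2), hg.comp (by fun_prop),
      fun _ => rfl⟩ _
  rw [ProbabilityMeasure.toMeasure_map] at hf ⊢
  rw [lintegral_map' hf measurable_fst.aemeasurable]
  exact lintegral_mono fun p => iInf_le _ _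

variable {f : X × U → ℝ≥0∞} {C : Set (X × ProbabilityMeasure U)}

/-- The integral of an infimum against `γ` is the infimum of `∫ g dΓ` over the lifts `Γ` of `γ`. The
two infima merge into one over the standard Borel space of all `Γ`, the integrand being set to `⊤`
where the first marginal violates the constraint `C`. -/
theorem LowerSemianalytic.iInf_lintegral (hf : LowerSemianalytic f) (hC : MeasurableSet C) :
    LowerSemianalytic fun x =>
      ⨅ γ : ProbabilityMeasure U, ⨅ _ : (x, γ) ∈ C, ∫⁻ u, f (x, u) ∂(γ : Measure U) := by
  classical
  obtain ⟨g, hg, hfg⟩ := hf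
  obtain rfl : f = fun p => ⨅ w, g (p, w) := funext hfg
  let D : Set (X × ProbabilityMeasure (U × ℝ)) :=
    (fun p => (p.1, p.2.map measurable_fst.aemeasurable)) ⁻¹' C
  have hD : MeasurableSet D :=
    (measurable_fst.prodMk (measurable_probabilityMeasure_fst.comp measurable_snd)) hC
  have hG : Measurable fun p : X × ProbabilityMeasure (U × ℝ) =>
      if p ∈ D then ∫⁻ q, g ((p.1, q.1), q.2) ∂(p.2 : Measure (U × ℝ)) else ⊤ :=
    Measurable.ite hD (measurable_lintegral_probabilityMeasure
      (g := fun q : X × (U × ℝ) => g ((q.1, q.2.1), q.2.2)) (hg.comp (by fun_prop)))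
      measurable_const
  convert lowerSemianalytic_iInf hG using 2 with x
  refine le_antisymm (le_iInf fun Γ => ?_) (le_iInf₂ fun γ hγ => ?_)
  · split_ifs with h
    · exact (iInf₂_le (Γ.map measurable_fst.aemeasurable) h).trans (lintegral_iInf_le_lift hg x Γ)
    · exact le_top
  · refine ENNReal.le_of_forall_pos_le_add fun ε hε _ => ?_
    obtain ⟨Γ, rfl, hΓ⟩ := exists_lift_lintegral_le hg x γ (coe_ne_zero.2 hε.ne')
    refine (iInf_le _ Γ).trans ?_
    rw [if_pos (show (x, Γ) ∈ D from hγ)]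
    exact hΓ

/-- Nearly optimal measures can be selected measurably, up to a null set. -/
theorem LowerSemianalytic.exists_measurable_near_iInf [StandardBorelSpace X] [Nonempty U]
    (hf : LowerSemianalytic f)
    (hC : MeasurableSet C) (π : Measure X) [IsFiniteMeasure π] (hne : ∀ᵐ x ∂π, ∃ γ, (x, γ) ∈ C)
    {ε : ℝ≥0∞} (hε : ε ≠ 0) :
    ∃ s : X → ProbabilityMeasure U, Measurable s ∧ ∀ᵐ x ∂π, (x, s x) ∈ C ∧
      ∫⁻ u, f (x, u) ∂(s x : Measure U) ≤
        (⨅ γ : ProbabilityMeasure U, ⨅ _ : (x, γ) ∈ C, ∫⁻ u, f (x, u) ∂(γ : Measure U)) + ε := by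
  have hF := (hf.iInf_lintegral hC).aemeasurable π
  obtain ⟨g, hg, hfg⟩ := hf
  obtain rfl : f = fun p => ⨅ w, g (p, w) := funext hfg
  have : Nonempty (ProbabilityMeasure (U × ℝ)) :=
    ⟨⟨Measure.dirac (Classical.arbitrary U, 0), inferInstance⟩⟩
  -- Lifts `Γ` are selected instead of `γ`, because `∫ g dΓ` is Borel in `(x, Γ)`. Half of `ε` is
  -- spent on the choice of `γ` and half on its lift.
  have hG : MeasurableSet {p : X × ProbabilityMeasure (U × ℝ) |
      (p.1, p.2.map measurable_fst.aemeasurable) ∈ C ∧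
      ∫⁻ q, g ((p.1, q.1), q.2) ∂(p.2 : Measure (U × ℝ)) ≤ hF.mk _ p.1 + ε} :=
    ((measurable_fst.prodMk (measurable_probabilityMeasure_fst.comp measurable_snd)) hC).inter
      (measurableSet_le (measurable_lintegral_probabilityMeasure
        (g := fun q : X × (U × ℝ) => g ((q.1, q.2.1), q.2.2)) (hg.comp (by fun_prop)))
        ((hF.measurable_mk.comp measurable_fst).add_const _))
  obtain ⟨s, hs, hsG⟩ := exists_measurable_selection π hG (by
    filter_upwards [hF.ae_eq_mk, hne] with x hx ⟨γ, hγ⟩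
    simp only [← hx]
    have h2 : ε / 2 ≠ 0 := by simp [hε]
    have : ∃ γ : ProbabilityMeasure U, (x, γ) ∈ C ∧
        ∫⁻ u, ⨅ w, g ((x, u), w) ∂(γ : Measure U) ≤
        (⨅ γ : ProbabilityMeasure U, ⨅ _ : (x, γ) ∈ C,
          ∫⁻ u, ⨅ w, g ((x, u), w) ∂(γ : Measure U)) + ε / 2 := by
      by_cases htop : (⨅ γ : ProbabilityMeasure U, ⨅ _ : (x, γ) ∈ C,
          ∫⁻ u, ⨅ w, g ((x, u), w) ∂(γ : Measure U)) = ⊤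
      · exact ⟨γ, hγ, by simp [htop]⟩
      · obtain ⟨γ', hγ'⟩ := iInf_lt_iff.1 (ENNReal.lt_add_right htop h2)
        obtain ⟨h, hγ''⟩ := iInf_lt_iff.1 hγ'
        exact ⟨γ', h, hγ''.le⟩
    obtain ⟨γ', hγ', hle⟩ := this
    obtain ⟨Γ, hΓ, hΓle⟩ := exists_lift_lintegral_le hg x γ' h2
    refine ⟨Γ, by rwa [hΓ], hΓle.trans ?_⟩
    calc _ ≤ _ := add_le_add_left hle _
      _ = _ := by rw [add_assoc, ENNReal.add_halves])
  refine ⟨fun x => (s x).map measurable_fst.aemeasurable,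
    measurable_probabilityMeasure_fst.comp hs, ?_⟩
  filter_upwards [hsG, hF.ae_eq_mk] with x hx hFx
  refine ⟨hx.1, (lintegral_iInf_le_lift hg x (s x)).trans ?_⟩
  rw [hFx]
  exact hx.2

end Projection

/-! ### Integrals of costs that are bounded from below -/

section ExtIntegral

theorem toENNReal_coe_sub (x : ℝ≥0∞) (b : NNReal) :
    ((x : EReal) - ((b : ℝ≥0∞) : EReal)).toENNReal = x - b := by
  rw [EReal.toENNReal_sub (EReal.coe_ennreal_nonneg _), EReal.toENNReal_coe, EReal.toENNReal_coe]

theorem toENNReal_neg_coe_sub (x : ℝ≥0∞) (b : NNReal) :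
    (-((x : EReal) - ((b : ℝ≥0∞) : EReal))).toENNReal = b - x := by
  rw [EReal.neg_sub (Or.inl (EReal.coe_ennreal_ne_bot _)) (Or.inr (by simp)), add_comm,
    ← sub_eq_add_neg, EReal.toENNReal_sub (EReal.coe_ennreal_nonneg _), EReal.toENNReal_coe,
    EReal.toENNReal_coe]

theorem continuous_coe_sub (b : NNReal) :
    Continuous fun x : ℝ≥0∞ => (x : EReal) - ((b : ℝ≥0∞) : EReal) := by
  refine continuous_iff_continuousAt.2 fun x => ?_
  simp only [sub_eq_add_neg]
  refine (EReal.continuousAt_add (Or.inr ?_) (Or.inr ?_)).comp (f := fun x : ℝ≥0∞ =>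
    ((x : EReal), -((b : ℝ≥0∞) : EReal)))
    (continuous_coe_ennreal_ereal.continuousAt.prodMk continuousAt_const)
  · simp [EReal.neg_eq_bot_iff]
  · simp [EReal.neg_eq_top_iff]

theorem strictMono_coe_sub (b : NNReal) :
    StrictMono fun x : ℝ≥0∞ => (x : EReal) - ((b : ℝ≥0∞) : EReal) := by
  intro x y hxy
  refine EReal.sub_lt_sub_of_lt_of_le (EReal.coe_ennreal_lt_coe_ennreal_iff.2 hxy) le_rfl
    (by simp) (by simp)

variable {α : Type*} [MeasurableSpace α] {γ : Measure α} [IsProbabilityMeasure γ]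
  {f : α → ℝ≥0∞} {b : NNReal}

theorem lintegral_const_tsub_ne_top (f : α → ℝ≥0∞) (b : NNReal) :
    ∫⁻ a, (b - f a) ∂γ ≠ ⊤ := by
  refine ne_top_of_le_ne_top (coe_ne_top (r := b)) ?_
  calc ∫⁻ a, (b - f a) ∂γ ≤ ∫⁻ _, (b : ℝ≥0∞) ∂γ := lintegral_mono fun a => tsub_le_self
    _ = b := by simp

theorem hasExtIntegral_coe_sub (hf : AEMeasurable f γ) :
    HasExtIntegral γ fun a => (f a : EReal) - ((b : ℝ≥0∞) : EReal) := by
  refine ⟨(continuous_coe_sub b).measurable.comp_aemeasurable hf, ?_⟩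
  simp only [toENNReal_neg_coe_sub]
  exact lintegral_const_tsub_ne_top f b

/-- Integrate `(f - b)⁺ + b = f + (b - f)⁺`; the last term has finite integral and may be moved to
the other side. -/
theorem extIntegral_coe_sub (hf : AEMeasurable f γ) :
    extIntegral γ (fun a => (f a : EReal) - ((b : ℝ≥0∞) : EReal))
      = ((∫⁻ a, f a ∂γ : ℝ≥0∞) : EReal) - ((b : ℝ≥0∞) : EReal) := by
  have hid : ∫⁻ a, (f a - b) ∂γ + b = ∫⁻ a, f a ∂γ + ∫⁻ a, (b - f a) ∂γ := by
    rw [← lintegral_add_left' hf]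
    trans ∫⁻ a, (f a - b + b) ∂γ
    · rw [lintegral_add_right _ measurable_const]; simp
    refine lintegral_congr fun a => ?_
    rw [tsub_add_eq_max, add_comm, tsub_add_eq_max, max_comm]
  have hB := lintegral_const_tsub_ne_top (γ := γ) f b
  simp only [extIntegral, toENNReal_coe_sub, toENNReal_neg_coe_sub]
  generalize ∫⁻ a, (f a - b) ∂γ = A at hid ⊢
  generalize ∫⁻ a, f a ∂γ = F at hid ⊢
  generalize ∫⁻ a, (b - f a) ∂γ = B at hid hB ⊢
  lift B to NNReal using hB
  induction A with
  | top =>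
    have : F = ⊤ := by
      by_contra h
      rw [top_add] at hid
      exact (ENNReal.add_ne_top.2 ⟨h, coe_ne_top⟩) hid.symm
    subst this
    rfl
  | coe A =>
    have : F ≠ ⊤ := by
      rintro rfl
      rw [top_add] at hid
      exact (ENNReal.add_ne_top.2 ⟨coe_ne_top, coe_ne_top⟩) hid
    lift F to NNReal using this
    have h : (A : ℝ) + b = F + B := by exact_mod_cast hid
    have h' : (A : ℝ) - B = F - b := by linarith
    simp only [EReal.coe_nnreal_eq_coe_real]
    exact_mod_cast congrArg (fun r : ℝ => (r : EReal)) h'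

end ExtIntegral

/-- The shift is monotone, continuous and sends `⊤` to `⊤`. The last point covers empty index types,
which occur because membership constraints are infima over propositions. -/
theorem iInf_coe_sub {ι : Sort*} (a : ι → ℝ≥0∞) (b : NNReal) :
    ⨅ i, ((a i : EReal) - ((b : ℝ≥0∞) : EReal)) =
      ((⨅ i, a i : ℝ≥0∞) : EReal) - ((b : ℝ≥0∞) : EReal) :=
  ((strictMono_coe_sub b).monotone.map_iInf_of_continuousAt (continuous_coe_sub b).continuousAt
    (by simp)).symm

theorem coe_toENNReal_add_sub {z : EReal} {b : NNReal} (hz : -((b : ℝ≥0∞) : EReal) ≤ z) :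
    ((z + ((b : ℝ≥0∞) : EReal)).toENNReal : EReal) - ((b : ℝ≥0∞) : EReal) = z := by
  rw [EReal.coe_nnreal_eq_coe_real] at hz ⊢
  induction z with
  | bot => exact absurd (le_bot_iff.1 hz) (EReal.coe_ne_bot (-(b : ℝ)))
  | top => simp
  | coe z =>
    have h : 0 ≤ z + b := by
      have : ((-(b : ℝ) : ℝ) : EReal) ≤ z := by exact_mod_cast hz
      have := EReal.coe_le_coe_iff.1 this
      linarith
    rw [EReal.coe_toENNReal (by exact_mod_cast h)]
    have : z + b - b = z := by ring
    exact_mod_cast congrArg (fun r : ℝ => (r : EReal)) this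

/-! ### The recursion for costs with values in `[0, ∞]` -/

section Recursion

variable {N : ℕ} {μ ν : Measure (Fin N → ℝ)} (κ : RegularKernels μ) (η : RegularKernels ν)

/-- The conditional law of the next coordinate as a kernel. -/
noncomputable def RegularKernels.stepKernel (t : Fin N) : Kernel (Fin t → ℝ) ℝ :=
  (κ.ker t).map fun z => z ⟨0, Nat.sub_pos_of_lt t.isLt⟩

theorem RegularKernels.stepKernel_apply (t : Fin N) (x : Fin t → ℝ) :
    κ.stepKernel t x = κ.step t x :=
  Kernel.map_apply _ (measurable_pi_apply _) _

instance (t : Fin N) : IsMarkovKernel (κ.stepKernel t) :=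
  have := κ.markov t
  Kernel.IsMarkovKernel.map _ (measurable_pi_apply _)

instance (t : Fin N) (x : Fin t → ℝ) : IsProbabilityMeasure (κ.step t x) := by
  rw [← κ.stepKernel_apply]; infer_instance

@[fun_prop]
theorem measurable_snocPath {α : Type*} [MeasurableSpace α] {t : ℕ} {f : α → Fin t → ℝ}
    {g : α → ℝ} (hf : Measurable f) (hg : Measurable g) :
    Measurable fun a => snocPath (f a) (g a) := by
  refine measurable_pi_lambda _ fun i => ?_
  refine Fin.lastCases ?_ (fun j => ?_) i
  · simpa [snocPath] using hg
  · simp only [snocPath, Fin.snoc_castSucc]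
    exact (measurable_pi_apply j).comp hf

/-- The nested problem for a cost with values in `[0, ∞]`. -/
noncomputable def nestedCost (c : (Fin N → ℝ) × (Fin N → ℝ) → ℝ≥0∞) :
    (k t : ℕ) → t + k = N → (Fin t → ℝ) → (Fin t → ℝ) → ℝ≥0∞
  | 0, _, h, x, y => c (fun i => x (Fin.cast h.symm i), fun i => y (Fin.cast h.symm i))
  | k + 1, t, h, x, y =>
      ⨅ γ ∈ couplings (κ.step ⟨t, by omega⟩ x) (η.step ⟨t, by omega⟩ y),
        ∫⁻ p, nestedCost c k (t + 1) (by omega) (snocPath x p.1) (snocPath y p.2)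
          ∂(γ : Measure (ℝ × ℝ))

/-- The value functions for a cost with values in `[0, ∞]`. -/
noncomputable def costFn (c : (Fin N → ℝ) × (Fin N → ℝ) → ℝ≥0∞) (t : ℕ) (ht : t ≤ N)
    (x y : Fin t → ℝ) : ℝ≥0∞ :=
  nestedCost κ η c (N - t) t (Nat.add_sub_of_le ht) x y

theorem nestedCost_congr (c : (Fin N → ℝ) × (Fin N → ℝ) → ℝ≥0∞) {k k' t : ℕ} (hk : k = k')
    (h : t + k = N) (h' : t + k' = N) (x y : Fin t → ℝ) :
    nestedCost κ η c k t h x y = nestedCost κ η c k' t h' x y := by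
  subst hk; rfl

theorem costFn_last (c : (Fin N → ℝ) × (Fin N → ℝ) → ℝ≥0∞) (x y : Fin N → ℝ) :
    costFn κ η c N le_rfl x y = c (x, y) :=
  nestedCost_congr κ η c (Nat.sub_self N) _ (Nat.add_zero N) x y

theorem costFn_of_lt (c : (Fin N → ℝ) × (Fin N → ℝ) → ℝ≥0∞) (t : Fin N) (x y : Fin t → ℝ) :
    costFn κ η c t t.isLt.le x y =
      ⨅ γ ∈ couplings (κ.step t x) (η.step t y),
        ∫⁻ p, costFn κ η c (t + 1) t.isLt (snocPath x p.1) (snocPath y p.2)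
          ∂(γ : Measure (ℝ × ℝ)) := by
  have ht := t.isLt
  exact nestedCost_congr κ η c (k' := (N - (t + 1)) + 1) (by omega) _ (by omega) x y

/-- The graph of the correspondence that maps a pair of histories to the couplings of the
conditional laws of the next coordinates. -/
def stepCouplings (t : Fin N) :
    Set (((Fin t → ℝ) × (Fin t → ℝ)) × ProbabilityMeasure (ℝ × ℝ)) :=
  {p | p.2 ∈ couplings (κ.step t p.1.1) (η.step t p.1.2)}

theorem measurableSet_stepCouplings (t : Fin N) : MeasurableSet (stepCouplings κ η t) := by
  let F : ∀ {μ : Measure (Fin N → ℝ)} (κ : RegularKernels μ), (Fin t → ℝ) → ProbabilityMeasure ℝ :=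
    fun κ x => ⟨κ.step t x, inferInstance⟩
  have hF : ∀ {μ : Measure (Fin N → ℝ)} (κ : RegularKernels μ), Measurable (F κ) := fun κ => by
    refine ProbabilityMeasure.measurable_of_measurable_coe ?_
    convert (κ.stepKernel t).measurable using 2 with x
    exact (κ.stepKernel_apply t x).symm
  have h1 : MeasurableSet {p : ((Fin t → ℝ) × (Fin t → ℝ)) × ProbabilityMeasure (ℝ × ℝ) |
      p.2.map measurable_fst.aemeasurable = F κ p.1.1} :=
    measurableSet_eq_fun (measurable_probabilityMeasure_fst.comp measurable_snd)
      ((hF κ).comp (measurable_fst.comp measurable_fst))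
  have h2 : MeasurableSet {p : ((Fin t → ℝ) × (Fin t → ℝ)) × ProbabilityMeasure (ℝ × ℝ) |
      p.2.map measurable_snd.aemeasurable = F η p.1.2} :=
    measurableSet_eq_fun (measurable_probabilityMeasure_snd.comp measurable_snd)
      ((hF η).comp (measurable_snd.comp measurable_fst))
  convert h1.inter h2 using 1
  ext p
  simp only [stepCouplings, couplings, mem_ofPred_eq, mem_inter_iff]
  exact ⟨fun h => ⟨Subtype.ext h.1, Subtype.ext h.2⟩,
    fun h => ⟨congrArg Subtype.val h.1, congrArg Subtype.val h.2⟩⟩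

theorem stepCouplings_nonempty (t : Fin N) (p : (Fin t → ℝ) × (Fin t → ℝ)) :
    ∃ γ, (p, γ) ∈ stepCouplings κ η t :=
  ⟨⟨(κ.step t p.1).prod (η.step t p.2), inferInstance⟩,
    Measure.fst_prod, Measure.snd_prod⟩

theorem lowerSemianalytic_nestedCost {c : (Fin N → ℝ) × (Fin N → ℝ) → ℝ≥0∞} (hc : Measurable c)
    (k t : ℕ) (h : t + k = N) :
    LowerSemianalytic fun p : (Fin t → ℝ) × (Fin t → ℝ) => nestedCost κ η c k t h p.1 p.2 := by
  induction k generalizing t with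
  | zero =>
    refine Measurable.lowerSemianalytic (hc.comp ?_)
    exact (measurable_pi_lambda _ fun i => (measurable_pi_apply _).comp measurable_fst).prodMk
      (measurable_pi_lambda _ fun i => (measurable_pi_apply _).comp measurable_snd)
  | succ k ih =>
    have h1 := (ih (t + 1) (by omega)).comp (φ := fun q : ((Fin t → ℝ) × (Fin t → ℝ)) × (ℝ × ℝ) =>
      (snocPath q.1.1 q.2.1, snocPath q.1.2 q.2.2)) (by fun_prop)
    exact h1.iInf_lintegral (measurableSet_stepCouplings κ η ⟨t, by omega⟩)

theorem lowerSemianalytic_costFn {c : (Fin N → ℝ) × (Fin N → ℝ) → ℝ≥0∞} (hc : Measurable c)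
    (t : ℕ) (ht : t ≤ N) :
    LowerSemianalytic fun p : (Fin t → ℝ) × (Fin t → ℝ) => costFn κ η c t ht p.1 p.2 :=
  lowerSemianalytic_nestedCost κ η hc _ _ _

theorem lowerSemianalytic_costFn_snoc {c : (Fin N → ℝ) × (Fin N → ℝ) → ℝ≥0∞} (hc : Measurable c)
    (t : Fin N) :
    LowerSemianalytic fun q : ((Fin t → ℝ) × (Fin t → ℝ)) × (ℝ × ℝ) =>
      costFn κ η c (t + 1) t.isLt (snocPath q.1.1 q.2.1) (snocPath q.1.2 q.2.2) :=
  (lowerSemianalytic_costFn κ η hc (t + 1) t.isLt).comp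
    (φ := fun q : ((Fin t → ℝ) × (Fin t → ℝ)) × (ℝ × ℝ) =>
      (snocPath q.1.1 q.2.1, snocPath q.1.2 q.2.2)) (by fun_prop)

theorem aemeasurable_nestedCost_snoc {c : (Fin N → ℝ) × (Fin N → ℝ) → ℝ≥0∞} (hc : Measurable c)
    {k t : ℕ} (h : t + 1 + k = N) (x y : Fin t → ℝ) (γ : Measure (ℝ × ℝ)) [IsFiniteMeasure γ] :
    AEMeasurable (fun p : ℝ × ℝ => nestedCost κ η c k (t + 1) h (snocPath x p.1) (snocPath y p.2))
      γ :=
  ((lowerSemianalytic_nestedCost κ η hc k (t + 1) h).comp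
    (φ := fun p : ℝ × ℝ => (snocPath x p.1, snocPath y p.2)) (by fun_prop)).aemeasurable γ

theorem nestedValue_eq_nestedCost_sub {c : (Fin N → ℝ) × (Fin N → ℝ) → ℝ≥0∞} (hc : Measurable c)
    (b : NNReal) (k t : ℕ) (h : t + k = N) (x y : Fin t → ℝ) :
    nestedValue κ η (fun p => (c p : EReal) - ((b : ℝ≥0∞) : EReal)) k t h x y
      = (nestedCost κ η c k t h x y : EReal) - ((b : ℝ≥0∞) : EReal) := by
  induction k generalizing t with
  | zero => rfl
  | succ k ih =>
    simp only [nestedValue, nestedCost, ih, ← iInf_coe_sub]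
    refine iInf_congr fun γ => iInf_congr fun _ => ?_
    exact extIntegral_coe_sub (aemeasurable_nestedCost_snoc κ η hc _ x y _)

end Recursion

/-! ### Compositions of measures and kernels -/

section CompProd

variable {α β δ : Type*} [MeasurableSpace α] [MeasurableSpace β] [MeasurableSpace δ]

theorem lintegral_compProd_of_aemeasurable {π : Measure α} [SFinite π] {K : Kernel α β}
    [IsSFiniteKernel K] {f : α × β → ℝ≥0∞} (hf : AEMeasurable f (π ⊗ₘ K)) :
    ∫⁻ p, f p ∂(π ⊗ₘ K) = ∫⁻ a, ∫⁻ b, f (a, b) ∂(K a) ∂π := by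
  rw [lintegral_congr_ae hf.ae_eq_mk, Measure.lintegral_compProd hf.measurable_mk]
  refine lintegral_congr_ae ?_
  filter_upwards [Measure.ae_ae_of_ae_compProd hf.ae_eq_mk] with a ha
  exact lintegral_congr_ae (ha.mono fun b hb => hb.symm)

theorem map_compProd_eq_map_compProd_comap {π : Measure α} [SFinite π] {f : α → δ}
    (hf : Measurable f) (K : Kernel δ β) [IsSFiniteKernel K] :
    π.map f ⊗ₘ K = (π ⊗ₘ K.comap f hf).map (Prod.map f id) := by
  ext s hs
  have hm : Measurable (Prod.map f (id : β → β)) := hf.prodMap measurable_id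
  rw [Measure.map_apply hm hs, Measure.compProd_apply hs, Measure.compProd_apply (hm hs),
    lintegral_map (Kernel.measurable_kernel_prodMk_left hs) hf]
  rfl

end CompProd

/-! ### One-step causality -/

section StepCausal

theorem head_comp_head {N s t : ℕ} (hst : s ≤ t) (htN : t ≤ N) (x : Fin N → ℝ) :
    head hst (head htN x) = head (hst.trans htN) x := rfl

theorem head_rfl {N : ℕ} : head (le_refl N) = id := rfl

theorem head_snocPath {s t : ℕ} (hst : s ≤ t) (x : Fin t → ℝ) (a : ℝ) :
    head (hst.trans t.le_succ) (snocPath x a) = head hst x := by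
  ext i
  exact Fin.snoc_castSucc (α := fun _ => ℝ) a x (Fin.castLE hst i)

theorem snocPath_last {t : ℕ} (x : Fin t → ℝ) (a : ℝ) (h : t < t + 1) :
    snocPath x a ⟨t, h⟩ = a :=
  Fin.snoc_last (α := fun _ => ℝ) a x

theorem snocPath_of_lt {t s : ℕ} (x : Fin t → ℝ) (a : ℝ) (h : s < t) :
    snocPath x a ⟨s, h.trans t.lt_succ_self⟩ = x ⟨s, h⟩ :=
  Fin.snoc_castSucc (α := fun _ => ℝ) a x ⟨s, h⟩

theorem snocPath_head {N t : ℕ} (ht : t < N) (x : Fin N → ℝ) :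
    snocPath (head ht.le x) (x ⟨t, ht⟩) = head (Nat.succ_le_of_lt ht) x := by
  ext i
  refine Fin.lastCases ?_ (fun j => ?_) i
  · exact Fin.snoc_last (α := fun _ => ℝ) _ _
  · exact Fin.snoc_castSucc (α := fun _ => ℝ) _ _ j

/-- The pair of the initial segments of length `t` of two paths. -/
def histories {n t : ℕ} (ht : t ≤ n) (ω : (Fin n → ℝ) × (Fin n → ℝ)) :
    (Fin t → ℝ) × (Fin t → ℝ) :=
  (head ht ω.1, head ht ω.2)

@[fun_prop]
theorem measurable_head_comp {α : Type*} [MeasurableSpace α] {n t : ℕ} (ht : t ≤ n)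
    {f : α → Fin n → ℝ} (hf : Measurable f) : Measurable fun a => head ht (f a) :=
  (measurable_head ht).comp hf

@[fun_prop]
theorem measurable_histories {n t : ℕ} (ht : t ≤ n) : Measurable (histories ht) := by
  unfold histories; fun_prop

theorem measurable_eval_comp {α : Type*} [MeasurableSpace α] {n : ℕ} (i : Fin n)
    {f : α → Fin n → ℝ} (hf : Measurable f) : Measurable fun a => f a i :=
  (measurable_pi_apply i).comp hf

variable {N : ℕ} {μ ν : Measure (Fin N → ℝ)}

/-- Given the histories `(x₁, …, xₜ)` and `(y₁, …, yₜ)`, the conditional law of `xₜ₊₁` under `γ`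
depends on the first history only, and is given by the kernel of `μ`. -/
def StepCausal (κ : RegularKernels μ) {n : ℕ} (γ : Measure ((Fin n → ℝ) × (Fin n → ℝ)))
    (t : Fin N) (ht : t < n) : Prop :=
  γ.map (fun ω => (histories ht.le ω, ω.1 ⟨t, ht⟩)) =
    γ.map (histories ht.le) ⊗ₘ (κ.stepKernel t).comap Prod.fst measurable_fst

theorem map_head_compProd_stepKernel [SFinite μ] (κ : RegularKernels μ) (t : Fin N) :
    μ.map (head t.isLt.le) ⊗ₘ κ.stepKernel t = μ.map fun x => (head t.isLt.le x, x t) := by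
  have := κ.markov t
  rw [RegularKernels.stepKernel, Measure.compProd_map (measurable_pi_apply _), κ.disintegrates,
    Measure.map_map (by fun_prop) ((measurable_head _).prodMk (measurable_tail _))]
  rfl

theorem setLIntegral_map_head_compProd_stepKernel [SFinite μ] (κ : RegularKernels μ) (t : Fin N)
    {g : (Fin t → ℝ) → ℝ≥0∞} (hg : Measurable g) {E : Set (Fin t → ℝ)} (hE : MeasurableSet E)
    {F : Set ℝ} (hF : MeasurableSet F) :
    ∫⁻ x in head t.isLt.le ⁻¹' E ∩ (fun x => x t) ⁻¹' F, g (head t.isLt.le x) ∂μ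
      = ∫⁻ h in E, g h * κ.step t h F ∂(μ.map (head t.isLt.le)) := by
  have hm : Measurable fun x : Fin N → ℝ => (head t.isLt.le x, x t) :=
    (measurable_head _).prodMk (measurable_pi_apply t)
  have h1 : ∫⁻ x in head t.isLt.le ⁻¹' E ∩ (fun x => x t) ⁻¹' F, g (head t.isLt.le x) ∂μ
      = ∫⁻ q in E ×ˢ F, g q.1 ∂(μ.map fun x => (head t.isLt.le x, x t)) := by
    rw [setLIntegral_map (hE.prod hF) (by fun_prop) hm]
    rfl
  rw [h1, ← map_head_compProd_stepKernel κ,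
    Measure.setLIntegral_compProd (by fun_prop) hE hF]
  refine lintegral_congr fun h => ?_
  simp [κ.stepKernel_apply]

/-- Causality makes the conditional probability of an event on `(y₁, …, yₜ)` given `x` a function
`g` of `(x₁, …, xₜ)`. So `xₜ₊₁` is conditionally independent of the history of `y` given that of
`x`, which is checked on rectangles. -/
theorem stepCausal_of_causal [IsProbabilityMeasure μ] (κ : RegularKernels μ)
    {γ : ProbabilityMeasure ((Fin N → ℝ) × (Fin N → ℝ))} (hγ : γ ∈ causalPlans μ ν) (t : Fin N) :
    StepCausal κ (γ : Measure ((Fin N → ℝ) × (Fin N → ℝ))) t t.isLt := by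
  obtain ⟨⟨hfst, -⟩, hcausal⟩ := hγ
  have hcond : ∀ B : Set (Fin t → ℝ), MeasurableSet B → ∃ g : (Fin t → ℝ) → ℝ≥0∞, Measurable g ∧
      (fun x => (γ : Measure ((Fin N → ℝ) × (Fin N → ℝ))).condKernel x (head t.isLt.le ⁻¹' B))
        =ᵐ[μ] fun x => g (head t.isLt.le x) := by
    intro B hB
    -- The definition of causality starts at `t = 1`; for `t = 0` the histories form a one-point
    -- space.
    rcases Nat.eq_zero_or_pos t with h0 | hpos
    · have : IsEmpty (Fin t) := by rw [h0]; infer_instance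
      rcases B.eq_empty_or_nonempty with rfl | hne
      · exact ⟨fun _ => 0, measurable_const, by simp⟩
      · rw [Subsingleton.eq_univ_of_nonempty hne]
        exact ⟨fun _ => 1, measurable_const, by simp⟩
    · obtain ⟨g, hg, hgeq⟩ := hcausal t hpos t.isLt.le _ ⟨B, hB, rfl⟩
      obtain ⟨g', hg', rfl⟩ := hg.exists_eq_measurable_comp
      exact ⟨g', hg', hgeq⟩
  have hdis : (γ : Measure ((Fin N → ℝ) × (Fin N → ℝ)))
      = μ ⊗ₘ (γ : Measure ((Fin N → ℝ) × (Fin N → ℝ))).condKernel := by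
    rw [← hfst]; exact (Measure.disintegrate _ _).symm
  set cK := (γ : Measure ((Fin N → ℝ) × (Fin N → ℝ))).condKernel with hcK
  have hm1 : Measurable fun ω : (Fin N → ℝ) × (Fin N → ℝ) =>
      (histories t.isLt.le ω, ω.1 ⟨t, t.isLt⟩) :=
    (measurable_histories _).prodMk (measurable_eval_comp _ measurable_fst)
  refine Measure.ext_prod₃' fun {E B F} hE hB hF => ?_
  obtain ⟨g, hg, hgeq⟩ := hcond B hB
  have hEm := measurable_head (N := N) t.isLt.le hE
  have hBm := measurable_head (N := N) t.isLt.le hB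
  rw [Measure.map_apply hm1 ((hE.prod hB).prod hF), Measure.compProd_apply_prod (hE.prod hB) hF,
    setLIntegral_map (hE.prod hB) (Kernel.measurable_coe _ hF) (measurable_histories _)]
  have hpre1 : (fun ω : (Fin N → ℝ) × (Fin N → ℝ) => (histories t.isLt.le ω, ω.1 ⟨t, t.isLt⟩)) ⁻¹'
      ((E ×ˢ B) ×ˢ F)
        = (head t.isLt.le ⁻¹' E ∩ (fun x => x t) ⁻¹' F) ×ˢ (head t.isLt.le ⁻¹' B) := by
    ext ω; simp [histories]; tauto
  have hpre2 : histories t.isLt.le ⁻¹' (E ×ˢ B)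
      = (head (N := N) t.isLt.le ⁻¹' E) ×ˢ (head t.isLt.le ⁻¹' B) := rfl
  have hstepm : Measurable fun h => κ.step t h F := by
    simp only [← κ.stepKernel_apply]; exact Kernel.measurable_coe _ hF
  rw [hpre1, hpre2]
  calc (γ : Measure ((Fin N → ℝ) × (Fin N → ℝ)))
        ((head t.isLt.le ⁻¹' E ∩ (fun x => x t) ⁻¹' F) ×ˢ (head t.isLt.le ⁻¹' B))
      = ∫⁻ x in head t.isLt.le ⁻¹' E ∩ (fun x => x t) ⁻¹' F, g (head t.isLt.le x) ∂μ := by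
        rw [hdis, Measure.compProd_apply_prod (hEm.inter ((measurable_pi_apply t) hF)) hBm]
        exact lintegral_congr_ae (ae_restrict_of_ae hgeq)
    _ = ∫⁻ h in E, g h * κ.step t h F ∂(μ.map (head t.isLt.le)) :=
        setLIntegral_map_head_compProd_stepKernel κ t hg hE hF
    _ = ∫⁻ x in head t.isLt.le ⁻¹' E, g (head t.isLt.le x) * κ.step t (head t.isLt.le x) F ∂μ :=
        setLIntegral_map hE (hg.mul hstepm) (measurable_head _)
    _ = ∫⁻ x in head t.isLt.le ⁻¹' E, ∫⁻ _ in head t.isLt.le ⁻¹' B,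
          κ.step t (head t.isLt.le x) F ∂(cK x) ∂μ := by
        refine lintegral_congr_ae (ae_restrict_of_ae ?_)
        filter_upwards [hgeq] with x hx
        rw [setLIntegral_const, ← hx, mul_comm]
    _ = ∫⁻ ω in (head (N := N) t.isLt.le ⁻¹' E) ×ˢ (head t.isLt.le ⁻¹' B),
          κ.step t (head t.isLt.le ω.1) F ∂(γ : Measure ((Fin N → ℝ) × (Fin N → ℝ))) := by
        conv_rhs => rw [hdis]
        rw [Measure.setLIntegral_compProd (f := fun ω : (Fin N → ℝ) × (Fin N → ℝ) =>
          κ.step t (head t.isLt.le ω.1) F) (hstepm.comp (by fun_prop)) hEm hBm]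
    _ = _ := by
        refine lintegral_congr fun ω => ?_
        rw [Kernel.comap_apply, κ.stepKernel_apply]
        rfl

end StepCausal

/-! ### Causality is equivalent to one-step causality -/

section Causal

variable {N : ℕ} {μ ν : Measure (Fin N → ℝ)}

theorem measurable_snocPath_histories {t : ℕ} :
    Measurable fun q : ((Fin t → ℝ) × (Fin t → ℝ)) × (ℝ × ℝ) =>
      (snocPath q.1.1 q.2.1, snocPath q.1.2 q.2.2) := by
  fun_prop

theorem StepCausal.apply_prod (κ : RegularKernels μ) {n : ℕ}
    {γ : Measure ((Fin n → ℝ) × (Fin n → ℝ))} [IsFiniteMeasure γ] {t : Fin N} {ht : t < n}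
    (h : StepCausal κ γ t ht) {E : Set ((Fin t → ℝ) × (Fin t → ℝ))} (hE : MeasurableSet E)
    {F : Set ℝ} (hF : MeasurableSet F) :
    γ.map (fun ω => (histories ht.le ω, ω.1 ⟨t, ht⟩)) (E ×ˢ F)
      = ∫⁻ ω in histories ht.le ⁻¹' E, κ.step t (head ht.le ω.1) F ∂γ := by
  rw [h, Measure.compProd_apply_prod hE hF,
    setLIntegral_map hE (Kernel.measurable_coe _ hF) (measurable_histories _)]
  simp only [Kernel.comap_apply, κ.stepKernel_apply]
  rfl

/-- If a plan is one-step causal, then for all `t` the conditional law of `(y₁, …, yₜ)` given a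
path `x` of the first component is a function of `(x₁, …, xₜ)`. -/
theorem map_prodMap_head_eq_compProd [IsProbabilityMeasure μ] (κ : RegularKernels μ)
    {γ : ProbabilityMeasure ((Fin N → ℝ) × (Fin N → ℝ))}
    (hstep : ∀ t : Fin N, StepCausal κ (γ : Measure ((Fin N → ℝ) × (Fin N → ℝ))) t t.isLt)
    {t : ℕ} (ht : t ≤ N) (R : Kernel (Fin t → ℝ) (Fin t → ℝ)) [IsMarkovKernel R]
    (hR : (γ : Measure ((Fin N → ℝ) × (Fin N → ℝ))).map (histories ht) = μ.map (head ht) ⊗ₘ R)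
    {s : ℕ} (hts : t ≤ s) (hs : s ≤ N) :
    (γ : Measure ((Fin N → ℝ) × (Fin N → ℝ))).map (fun ω => (head hs ω.1, head ht ω.2))
      = μ.map (head hs) ⊗ₘ R.comap (head hts) (measurable_head hts) := by
  induction s, hts using Nat.le_induction with
  | base => exact hR
  | succ s hts ih =>
    specialize ih (Nat.le_of_succ_le hs)
    let unsnoc : (Fin (s + 1) → ℝ) → (Fin s → ℝ) × ℝ := fun z => (head s.le_succ z, z (Fin.last s))
    have hun : Measurable unsnoc :=
      (measurable_head _).prodMk (measurable_pi_apply _)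
    have hsn : Measurable fun q : ((Fin s → ℝ) × ℝ) × (Fin t → ℝ) => (snocPath q.1.1 q.1.2, q.2) := by
      fun_prop
    have hunm : Measurable fun q : (Fin (s + 1) → ℝ) × (Fin t → ℝ) => (unsnoc q.1, q.2) := by
      fun_prop
    have hinv : ∀ π : Measure ((Fin (s + 1) → ℝ) × (Fin t → ℝ)),
        (π.map fun q => (unsnoc q.1, q.2)).map (fun q => (snocPath q.1.1 q.1.2, q.2)) = π := by
      intro π
      rw [Measure.map_map hsn hunm]
      convert Measure.map_id using 2
      ext q : 1
      refine Prod.ext ?_ rfl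
      ext i
      refine Fin.lastCases ?_ (fun j => ?_) i
      · exact Fin.snoc_last (α := fun _ => ℝ) _ _
      · exact Fin.snoc_castSucc (α := fun _ => ℝ) _ _ j
    rw [← hinv (Measure.map _ _), ← hinv (_ ⊗ₘ _)]
    congr 1
    have hsN : s < N := hs
    set g := γ.toMeasure
    have hm1 : Measurable fun ω : (Fin N → ℝ) × (Fin N → ℝ) => (head hs ω.1, head ht ω.2) := by
      fun_prop
    refine Measure.ext_prod₃' fun {E F B} hE hF hB => ?_
    have hstepm : Measurable fun h => κ.step ⟨s, hsN⟩ h F := by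
      simp only [← κ.stepKernel_apply]; exact Kernel.measurable_coe _ hF
    have hRm : Measurable fun h : Fin s → ℝ => R (head hts h) B :=
      (Kernel.measurable_coe R hB).comp (measurable_head hts)
    have hRm' : Measurable fun h : Fin (s + 1) → ℝ => R (head (Nat.le_succ_of_le hts) h) B :=
      (Kernel.measurable_coe R hB).comp (measurable_head _)
    have hBm : MeasurableSet (head hts ⁻¹' B) := measurable_head hts hB
    rw [Measure.map_apply hunm ((hE.prod hF).prod hB), Measure.map_apply hunm ((hE.prod hF).prod hB),
      Measure.map_apply hm1 (hunm ((hE.prod hF).prod hB))]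
    -- One-step causality at time `s` is applied to an event that constrains only the first `t ≤ s`
    -- coordinates of `y`.
    have hlhs : g ((fun ω => (head hs ω.1, head ht ω.2)) ⁻¹'
        ((fun q => (unsnoc q.1, q.2)) ⁻¹' ((E ×ˢ F) ×ˢ B)))
        = (g.map fun ω => (histories hsN.le ω, ω.1 ⟨s, hsN⟩)) ((E ×ˢ (head hts ⁻¹' B)) ×ˢ F) := by
      rw [Measure.map_apply ((measurable_histories _).prodMk (measurable_eval_comp _ measurable_fst))
        ((hE.prod hBm).prod hF)]
      congr 1
      ext ω
      simp only [mem_preimage, mem_prod, unsnoc, histories, head_comp_head]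
      tauto
    have hrhs : (fun q : (Fin (s + 1) → ℝ) × (Fin t → ℝ) => (unsnoc q.1, q.2)) ⁻¹' ((E ×ˢ F) ×ˢ B)
        = (unsnoc ⁻¹' (E ×ˢ F)) ×ˢ B := rfl
    rw [hlhs, hrhs, (hstep ⟨s, hsN⟩).apply_prod κ (hE.prod hBm) hF,
      Measure.compProd_apply_prod (hun (hE.prod hF)) hB]
    calc _ = ∫⁻ q in E ×ˢ B, κ.step ⟨s, hsN⟩ q.1 F
            ∂(g.map fun ω => (head hsN.le ω.1, head ht ω.2)) := by
          rw [setLIntegral_map (hE.prod hB) (by fun_prop) (by fun_prop)]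
          rfl
      _ = ∫⁻ h in E, R (head hts h) B * κ.step ⟨s, hsN⟩ h F ∂(μ.map (head hsN.le)) := by
          rw [ih, Measure.setLIntegral_compProd (by fun_prop) hE hB]
          simp only [setLIntegral_const, Kernel.comap_apply, mul_comm]
      _ = ∫⁻ x in head hsN.le ⁻¹' E ∩ (fun x => x ⟨s, hsN⟩) ⁻¹' F, R (head ht x) B ∂μ :=
          (setLIntegral_map_head_compProd_stepKernel κ ⟨s, hsN⟩ hRm hE hF).symm
      _ = ∫⁻ h in unsnoc ⁻¹' (E ×ˢ F), R (head (Nat.le_succ_of_le hts) h) B ∂(μ.map (head hs)) := by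
          rw [setLIntegral_map (hun (hE.prod hF)) hRm' (measurable_head _)]
          rfl

/-- With `s = N`, `map_prodMap_head_eq_compProd` says that `R (head ht x)` is a conditional law of
`(y₁, …, yₜ)` given the whole path `x`; uniqueness of disintegrations identifies it with the image
of `γˣ`. -/
theorem causal_of_stepCausal [IsProbabilityMeasure μ] (κ : RegularKernels μ)
    {γ : ProbabilityMeasure ((Fin N → ℝ) × (Fin N → ℝ))} (hγ : γ ∈ couplings μ ν)
    (hstep : ∀ t : Fin N, StepCausal κ (γ : Measure ((Fin N → ℝ) × (Fin N → ℝ))) t t.isLt) :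
    γ ∈ causalPlans μ ν := by
  refine ⟨hγ, fun t _ ht B hB => ?_⟩
  obtain ⟨B, hB, rfl⟩ := hB
  set g := γ.toMeasure
  have hfst : g.fst = μ := hγ.1
  let R := (g.map (histories ht)).condKernel
  have : IsProbabilityMeasure (g.map (histories ht)) :=
    Measure.isProbabilityMeasure_map (measurable_histories ht).aemeasurable
  have hR : g.map (histories ht) = μ.map (head ht) ⊗ₘ R := by
    rw [← hfst, Measure.fst, Measure.map_map (measurable_head _) measurable_fst]
    refine (Measure.disintegrate (g.map (histories ht)) R).symm.trans ?_
    rw [Measure.fst, Measure.map_map measurable_fst (measurable_histories ht)]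
    rfl
  have h1 := map_prodMap_head_eq_compProd κ hstep ht R hR ht le_rfl
  have h2 : g = μ ⊗ₘ g.condKernel := by
    conv_lhs => rw [← Measure.disintegrate g g.condKernel, hfst]
  have h3 : μ ⊗ₘ g.condKernel.map (head ht) = μ ⊗ₘ R.comap (head ht) (measurable_head ht) := by
    rw [Measure.compProd_map (measurable_head ht), ← h2]
    rw [head_rfl, Measure.map_id] at h1
    exact h1
  have h4 := Kernel.ae_eq_of_compProd_eq h3
  refine ⟨fun x => R (head ht x) B, (Kernel.measurable_coe R hB).comp (comap_measurable _), ?_⟩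
  filter_upwards [h4] with x hx
  rw [← Measure.map_apply (measurable_head ht) hB, ← Kernel.map_apply _ (measurable_head ht), hx]
  rfl

theorem mem_causalPlans_iff [IsProbabilityMeasure μ] (κ : RegularKernels μ)
    {γ : ProbabilityMeasure ((Fin N → ℝ) × (Fin N → ℝ))} :
    γ ∈ causalPlans μ ν ↔ γ ∈ couplings μ ν ∧
      ∀ t : Fin N, StepCausal κ (γ : Measure ((Fin N → ℝ) × (Fin N → ℝ))) t t.isLt :=
  ⟨fun h => ⟨h.1, stepCausal_of_causal κ h⟩, fun h => causal_of_stepCausal κ h.1 h.2⟩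

theorem swap_mem_couplings {γ : ProbabilityMeasure ((Fin N → ℝ) × (Fin N → ℝ))}
    (hγ : γ ∈ couplings μ ν) : γ.map measurable_swap.aemeasurable ∈ couplings ν μ :=
  ⟨(Measure.fst_map_swap).trans hγ.2, (Measure.snd_map_swap).trans hγ.1⟩

theorem mem_bicausalPlans_iff [IsProbabilityMeasure μ] [IsProbabilityMeasure ν]
    (κ : RegularKernels μ) (η : RegularKernels ν)
    {γ : ProbabilityMeasure ((Fin N → ℝ) × (Fin N → ℝ))} :
    γ ∈ bicausalPlans μ ν ↔ γ ∈ couplings μ ν ∧ ∀ t : Fin N,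
      StepCausal κ (γ : Measure ((Fin N → ℝ) × (Fin N → ℝ))) t t.isLt ∧
      StepCausal η ((γ : Measure ((Fin N → ℝ) × (Fin N → ℝ))).map Prod.swap) t t.isLt := by
  rw [bicausalPlans, mem_ofPred_eq, mem_causalPlans_iff κ, mem_causalPlans_iff η]
  exact ⟨fun h => ⟨h.1.1, fun t => ⟨h.1.2 t, h.2.2 t⟩⟩,
    fun h => ⟨⟨h.1, fun t => (h.2 t).1⟩, swap_mem_couplings h.1, fun t => (h.2 t).2⟩⟩

end Causal

/-! ### The dynamic programming principle -/

section SwapKernel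

variable {α β : Type*} [MeasurableSpace α] [MeasurableSpace β]

/-- The kernel with the two components exchanged in both the source and the target. -/
noncomputable def swapKernel (K : Kernel (α × α) (β × β)) : Kernel (α × α) (β × β) :=
  (K.comap Prod.swap measurable_swap).map Prod.swap

instance (K : Kernel (α × α) (β × β)) [IsMarkovKernel K] : IsMarkovKernel (swapKernel K) :=
  Kernel.IsMarkovKernel.map _ measurable_swap

theorem swapKernel_fst (K : Kernel (α × α) (β × β)) (p : α × α) :
    (swapKernel K p).fst = (K p.swap).snd := by
  rw [swapKernel, Kernel.map_apply _ measurable_swap, Measure.fst_map_swap]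
  rfl

theorem map_swap_compProd_swapKernel (π : Measure (α × α)) [SFinite π]
    (K : Kernel (α × α) (β × β)) [IsMarkovKernel K] :
    π.map Prod.swap ⊗ₘ swapKernel K = (π ⊗ₘ K).map (Prod.map Prod.swap Prod.swap) := by
  have h : (swapKernel K).comap Prod.swap measurable_swap = K.map Prod.swap := by
    ext p : 1
    rw [Kernel.comap_apply, swapKernel, Kernel.map_apply _ measurable_swap,
      Kernel.map_apply _ measurable_swap]
    rfl
  rw [map_compProd_eq_map_compProd_comap measurable_swap, h, Measure.compProd_map measurable_swap,
    Measure.map_map (by fun_prop) (by fun_prop)]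
  rfl

end SwapKernel

/-! ### Lower bound: no bicausal plan beats the recursion -/

section Verification

variable {N : ℕ} {μ ν : Measure (Fin N → ℝ)} (κ : RegularKernels μ) (η : RegularKernels ν)

theorem ae_map_fst_eq_step {n : ℕ} {γ : Measure ((Fin n → ℝ) × (Fin n → ℝ))}
    [IsProbabilityMeasure γ] {t : Fin N} {ht : t < n} (h : StepCausal κ γ t ht)
    {K : Kernel ((Fin t → ℝ) × (Fin t → ℝ)) (ℝ × ℝ)} [IsMarkovKernel K]
    (hK : γ.map (histories ht.le) ⊗ₘ K =
      γ.map fun ω => (histories ht.le ω, (ω.1 ⟨t, ht⟩, ω.2 ⟨t, ht⟩))) :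
    ∀ᵐ p ∂γ.map (histories ht.le), (K p).fst = κ.step t p.1 := by
  have : γ.map (histories ht.le) ⊗ₘ K.map Prod.fst
      = γ.map (histories ht.le) ⊗ₘ (κ.stepKernel t).comap Prod.fst measurable_fst := by
    rw [Measure.compProd_map measurable_fst, hK, Measure.map_map (by fun_prop)
      ((measurable_histories _).prodMk ((measurable_eval_comp _ measurable_fst).prodMk
        (measurable_eval_comp _ measurable_snd))), ← h]
    rfl
  filter_upwards [Kernel.ae_eq_of_compProd_eq this] with p hp
  rw [Kernel.map_apply _ measurable_fst, Kernel.comap_apply, κ.stepKernel_apply] at hp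
  exact hp

/-- The conditional law of the next pair of coordinates given the histories is almost surely a
coupling of the two step laws, hence a competitor in the infimum defining the value at time `t`. -/
theorem lintegral_costFn_le {c : (Fin N → ℝ) × (Fin N → ℝ) → ℝ≥0∞} (hc : Measurable c)
    {γ : Measure ((Fin N → ℝ) × (Fin N → ℝ))} [IsProbabilityMeasure γ] (t : Fin N)
    (h1 : StepCausal κ γ t t.isLt) (h2 : StepCausal η (γ.map Prod.swap) t t.isLt) :
    ∫⁻ ω, costFn κ η c t t.isLt.le (head t.isLt.le ω.1) (head t.isLt.le ω.2) ∂γ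
      ≤ ∫⁻ ω, costFn κ η c (t + 1) t.isLt (head t.isLt ω.1) (head t.isLt ω.2) ∂γ := by
  have hm : Measurable fun ω : (Fin N → ℝ) × (Fin N → ℝ) =>
      (histories t.isLt.le ω, (ω.1 t, ω.2 t)) :=
    (measurable_histories _).prodMk ((measurable_eval_comp _ measurable_fst).prodMk
      (measurable_eval_comp _ measurable_snd))
  set ρ := γ.map fun ω => (histories t.isLt.le ω, (ω.1 t, ω.2 t)) with hρ
  have : IsProbabilityMeasure ρ := Measure.isProbabilityMeasure_map hm.aemeasurable
  have hρfst : ρ.fst = γ.map (histories t.isLt.le) := by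
    rw [Measure.fst, Measure.map_map measurable_fst hm]
    rfl
  have : IsProbabilityMeasure (γ.map (histories t.isLt.le)) :=
    Measure.isProbabilityMeasure_map (measurable_histories _).aemeasurable
  have hdis : γ.map (histories t.isLt.le) ⊗ₘ ρ.condKernel = ρ := by
    rw [← hρfst]; exact Measure.disintegrate ρ ρ.condKernel
  have hK1 := ae_map_fst_eq_step κ h1 hdis
  -- The second marginal is the first marginal of the disintegration of the swapped plan.
  have hK2 : ∀ᵐ p ∂γ.map (histories t.isLt.le), (ρ.condKernel p).snd = η.step t p.2 := by
    have : IsProbabilityMeasure (γ.map Prod.swap) :=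
      Measure.isProbabilityMeasure_map measurable_swap.aemeasurable
    have hsw' : (γ.map Prod.swap).map (histories t.isLt.le)
        = (γ.map (histories t.isLt.le)).map Prod.swap := by
      rw [Measure.map_map (measurable_histories _) measurable_swap,
        Measure.map_map measurable_swap (measurable_histories _)]
      rfl
    have hK : (γ.map Prod.swap).map (histories t.isLt.le) ⊗ₘ swapKernel ρ.condKernel =
        (γ.map Prod.swap).map fun ω => (histories t.isLt.le ω, (ω.1 t, ω.2 t)) := by
      rw [hsw', map_swap_compProd_swapKernel, hdis, hρ, Measure.map_map (by fun_prop) hm,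
        Measure.map_map hm measurable_swap]
      rfl
    have := ae_map_fst_eq_step η h2 hK
    rw [hsw'] at this
    refine (ae_of_ae_map measurable_swap.aemeasurable this).mono fun p hp => ?_
    rw [swapKernel_fst, Prod.swap_swap] at hp
    exact hp
  have hV := (lowerSemianalytic_costFn κ η hc t t.isLt.le).aemeasurable (γ.map (histories t.isLt.le))
  have hV' := (lowerSemianalytic_costFn_snoc κ η hc t).aemeasurable
    (γ.map (histories t.isLt.le) ⊗ₘ ρ.condKernel)
  calc ∫⁻ ω, costFn κ η c t t.isLt.le (head t.isLt.le ω.1) (head t.isLt.le ω.2) ∂γ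
      = ∫⁻ p, costFn κ η c t t.isLt.le p.1 p.2 ∂(γ.map (histories t.isLt.le)) :=
        (lintegral_map' hV (measurable_histories _).aemeasurable).symm
    _ ≤ ∫⁻ p, ∫⁻ q, costFn κ η c (t + 1) t.isLt (snocPath p.1 q.1) (snocPath p.2 q.2)
          ∂(ρ.condKernel p) ∂(γ.map (histories t.isLt.le)) := by
        refine lintegral_mono_ae ?_
        filter_upwards [hK1, hK2] with p hp1 hp2
        rw [costFn_of_lt]
        exact iInf₂_le (⟨ρ.condKernel p, inferInstance⟩ : ProbabilityMeasure (ℝ × ℝ)) ⟨hp1, hp2⟩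
    _ = ∫⁻ q, costFn κ η c (t + 1) t.isLt (snocPath q.1.1 q.2.1) (snocPath q.1.2 q.2.2) ∂ρ := by
        rw [← lintegral_compProd_of_aemeasurable hV', hdis]
    _ = _ := by
        rw [hdis] at hV'
        rw [lintegral_map' hV' hm.aemeasurable]
        refine lintegral_congr fun ω => ?_
        simp only [histories]
        congr 1
        · exact snocPath_head t.isLt ω.1
        · exact snocPath_head t.isLt ω.2

theorem costFn_zero_le_lintegral [IsProbabilityMeasure μ] [IsProbabilityMeasure ν]
    {c : (Fin N → ℝ) × (Fin N → ℝ) → ℝ≥0∞} (hc : Measurable c)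
    {γ : ProbabilityMeasure ((Fin N → ℝ) × (Fin N → ℝ))} (hγ : γ ∈ bicausalPlans μ ν) :
    costFn κ η c 0 N.zero_le Fin.elim0 Fin.elim0
      ≤ ∫⁻ ω, c ω ∂(γ : Measure ((Fin N → ℝ) × (Fin N → ℝ))) := by
  rw [mem_bicausalPlans_iff κ η] at hγ
  have key : ∀ t (ht : t ≤ N), costFn κ η c 0 N.zero_le Fin.elim0 Fin.elim0
      ≤ ∫⁻ ω, costFn κ η c t ht (head ht ω.1) (head ht ω.2)
        ∂(γ : Measure ((Fin N → ℝ) × (Fin N → ℝ))) := by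
    intro t ht
    induction t with
    | zero =>
      have : ∀ ω : (Fin N → ℝ) × (Fin N → ℝ),
          costFn κ η c 0 ht (head ht ω.1) (head ht ω.2)
            = costFn κ η c 0 N.zero_le Fin.elim0 Fin.elim0 := fun ω => by
        congr 1 <;> exact Subsingleton.elim _ _
      simp [this]
    | succ t ih =>
      exact (ih (Nat.le_of_succ_le ht)).trans (lintegral_costFn_le κ η hc ⟨t, ht⟩
        (hγ.2 ⟨t, ht⟩).1 (hγ.2 ⟨t, ht⟩).2)
  refine (key N le_rfl).trans_eq (lintegral_congr fun ω => ?_)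
  exact costFn_last κ η c ω.1 ω.2

end Verification

/-! ### Upper bound: gluing nearly optimal one-step couplings -/

section Gluing

variable {N : ℕ} {μ ν : Measure (Fin N → ℝ)}

/-- The joint law of two paths of length `t` and of their prolongations by one step. -/
noncomputable def glue {t : ℕ} (γ : Measure ((Fin t → ℝ) × (Fin t → ℝ)))
    (K : Kernel ((Fin t → ℝ) × (Fin t → ℝ)) (ℝ × ℝ)) :
    Measure ((Fin (t + 1) → ℝ) × (Fin (t + 1) → ℝ)) :=
  (γ ⊗ₘ K).map fun q => (snocPath q.1.1 q.2.1, snocPath q.1.2 q.2.2)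

instance {t : ℕ} (γ : Measure ((Fin t → ℝ) × (Fin t → ℝ))) [IsProbabilityMeasure γ]
    (K : Kernel ((Fin t → ℝ) × (Fin t → ℝ)) (ℝ × ℝ)) [IsMarkovKernel K] :
    IsProbabilityMeasure (glue γ K) :=
  Measure.isProbabilityMeasure_map measurable_snocPath_histories.aemeasurable

theorem glue_map_swap {t : ℕ} (γ : Measure ((Fin t → ℝ) × (Fin t → ℝ))) [IsProbabilityMeasure γ]
    (K : Kernel ((Fin t → ℝ) × (Fin t → ℝ)) (ℝ × ℝ)) [IsMarkovKernel K] :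
    (glue γ K).map Prod.swap
      = glue (γ.map Prod.swap) (swapKernel K) := by
  rw [glue, glue, map_swap_compProd_swapKernel, Measure.map_map measurable_swap
    measurable_snocPath_histories, Measure.map_map measurable_snocPath_histories (by fun_prop)]
  rfl

section

variable {t : Fin N} {γ : Measure ((Fin t → ℝ) × (Fin t → ℝ))} [IsProbabilityMeasure γ]
  {K : Kernel ((Fin t → ℝ) × (Fin t → ℝ)) (ℝ × ℝ)} [IsMarkovKernel K]

theorem map_histories_glue {s : ℕ} (hs : s ≤ t) :
    (glue γ K).map (histories (hs.trans (Nat.le_succ t))) = γ.map (histories hs) := by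
  rw [glue, Measure.map_map (measurable_histories _) measurable_snocPath_histories]
  conv_rhs => rw [← Measure.fst_compProd γ K, Measure.fst,
    Measure.map_map (measurable_histories _) measurable_fst]
  congr 1
  ext q : 1
  exact Prod.ext (head_snocPath hs _ _) (head_snocPath hs _ _)

theorem compProd_map_fst_of_ae (κ : RegularKernels μ)
    (hK : ∀ᵐ p ∂γ, (K p).fst = κ.step t p.1) :
    (γ ⊗ₘ K).map (fun q => (q.1, q.2.1))
      = γ ⊗ₘ (κ.stepKernel t).comap Prod.fst measurable_fst := by
  let S : Kernel ((Fin t → ℝ) × (Fin t → ℝ)) ℝ := (κ.stepKernel t).comap Prod.fst measurable_fst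
  have h : K.map Prod.fst =ᵐ[γ] S := by
    filter_upwards [hK] with p hp
    rw [Kernel.map_apply _ measurable_fst, Kernel.comap_apply, κ.stepKernel_apply]
    exact hp
  rw [← Measure.compProd_congr h, Measure.compProd_map measurable_fst]
  rfl

theorem fst_glue [IsProbabilityMeasure μ] (κ : RegularKernels μ)
    (hγ : γ.fst = μ.map (head t.isLt.le))
    (hK : ∀ᵐ p ∂γ, (K p).fst = κ.step t p.1) : (glue γ K).fst = μ.map (head t.isLt) := by
  have h : (glue γ K).fst = (((γ ⊗ₘ K).map (fun q => (q.1, q.2.1))).map (Prod.map Prod.fst id)).map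
      fun r => snocPath r.1 r.2 := by
    rw [glue, Measure.fst, Measure.map_map measurable_fst measurable_snocPath_histories,
      Measure.map_map (by fun_prop) (by fun_prop), Measure.map_map (by fun_prop) (by fun_prop)]
    rfl
  rw [h, compProd_map_fst_of_ae κ hK, ← map_compProd_eq_map_compProd_comap measurable_fst,
    show γ.map Prod.fst = _ from hγ, map_head_compProd_stepKernel,
    Measure.map_map (by fun_prop) ((measurable_head _).prodMk (measurable_pi_apply t))]
  congr 1
  ext x : 1
  exact snocPath_head t.isLt x

theorem stepCausal_glue (κ : RegularKernels μ) (hK : ∀ᵐ p ∂γ, (K p).fst = κ.step t p.1) :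
    StepCausal κ (glue γ K) t (Nat.lt_succ_self t) := by
  have hm : Measurable fun ω : (Fin (t + 1) → ℝ) × (Fin (t + 1) → ℝ) =>
      (histories (Nat.lt_succ_self t).le ω, ω.1 ⟨t, Nat.lt_succ_self t⟩) :=
    (measurable_histories _).prodMk (measurable_eval_comp _ measurable_fst)
  rw [StepCausal, map_histories_glue le_rfl, show γ.map (histories le_rfl) = γ from Measure.map_id,
    ← compProd_map_fst_of_ae κ hK, glue, Measure.map_map hm measurable_snocPath_histories]
  congr 1
  ext q : 1
  exact Prod.ext (Prod.ext (head_snocPath le_rfl _ _) (head_snocPath le_rfl _ _))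
    (snocPath_last _ _ _)

theorem StepCausal.glue (κ : RegularKernels μ) {s : Fin N} {hs : (s : ℕ) < t}
    (h : StepCausal κ γ s hs) : StepCausal κ (glue γ K) s (hs.trans (Nat.lt_succ_self t)) := by
  have hm : Measurable fun ω : (Fin (t + 1) → ℝ) × (Fin (t + 1) → ℝ) =>
      (histories (hs.trans (Nat.lt_succ_self t)).le ω, ω.1 ⟨s, hs.trans (Nat.lt_succ_self t)⟩) :=
    (measurable_histories _).prodMk (measurable_eval_comp _ measurable_fst)
  have hm' : Measurable fun ω : (Fin t → ℝ) × (Fin t → ℝ) => (histories hs.le ω, ω.1 ⟨s, hs⟩) :=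
    (measurable_histories _).prodMk (measurable_eval_comp _ measurable_fst)
  rw [StepCausal, map_histories_glue hs.le, ← h, BicausalOT.glue,
    Measure.map_map hm measurable_snocPath_histories]
  conv_rhs => rw [← Measure.fst_compProd γ K, Measure.fst, Measure.map_map hm' measurable_fst]
  congr 1
  ext q : 1
  exact Prod.ext (Prod.ext (head_snocPath hs.le _ _) (head_snocPath hs.le _ _))
    (snocPath_of_lt _ _ hs)

end

variable (κ : RegularKernels μ) (η : RegularKernels ν)

/-- Each step appends a measurably selected `ε`-optimal coupling kernel and loses at most `ε`.
One-step causality at earlier times survives because gluing leaves the law of the existing prefix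
unchanged. -/
theorem exists_near_optimal_prefix [IsProbabilityMeasure μ] [IsProbabilityMeasure ν]
    {c : (Fin N → ℝ) × (Fin N → ℝ) → ℝ≥0∞} (hc : Measurable c) {ε : ℝ≥0∞} (hε : ε ≠ 0)
    (t : ℕ) (ht : t ≤ N) :
    ∃ γ : Measure ((Fin t → ℝ) × (Fin t → ℝ)), IsProbabilityMeasure γ ∧
      γ.fst = μ.map (head ht) ∧ γ.snd = ν.map (head ht) ∧
      (∀ (s : Fin N) (hs : (s : ℕ) < t), StepCausal κ γ s hs ∧ StepCausal η (γ.map Prod.swap) s hs) ∧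
      ∫⁻ ω, costFn κ η c t ht ω.1 ω.2 ∂γ
        ≤ costFn κ η c 0 N.zero_le Fin.elim0 Fin.elim0 + t * ε := by
  induction t with
  | zero =>
    have h1 : IsProbabilityMeasure (μ.map (head ht)) :=
      Measure.isProbabilityMeasure_map (measurable_head ht).aemeasurable
    have h2 : IsProbabilityMeasure (ν.map (head ht)) :=
      Measure.isProbabilityMeasure_map (measurable_head ht).aemeasurable
    refine ⟨(μ.map (head ht)).prod (ν.map (head ht)), inferInstance, Measure.fst_prod,
      Measure.snd_prod, fun s hs => absurd hs (Nat.not_lt_zero _), ?_⟩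
    have : ∀ ω : (Fin 0 → ℝ) × (Fin 0 → ℝ), costFn κ η c 0 ht ω.1 ω.2
        = costFn κ η c 0 N.zero_le Fin.elim0 Fin.elim0 := fun ω => by
      congr 1 <;> exact Subsingleton.elim _ _
    simp [this]
  | succ t ih =>
    obtain ⟨γ, hγ, hfst, hsnd, hstep, hcost⟩ := ih (Nat.le_of_succ_le ht)
    let t' : Fin N := ⟨t, ht⟩
    obtain ⟨s, hs, hsC⟩ := (lowerSemianalytic_costFn_snoc κ η hc t').exists_measurable_near_iInf
      (measurableSet_stepCouplings κ η t') γ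
      (Eventually.of_forall fun p => stepCouplings_nonempty κ η t' p) hε
    let K : Kernel ((Fin t → ℝ) × (Fin t → ℝ)) (ℝ × ℝ) :=
      ⟨fun p => s p, ProbabilityMeasure.measurable_coe.comp hs⟩
    have : IsMarkovKernel K :=
      ⟨fun p => inferInstanceAs (IsProbabilityMeasure (s p : Measure (ℝ × ℝ)))⟩
    have hsw : IsProbabilityMeasure (γ.map Prod.swap) :=
      Measure.isProbabilityMeasure_map measurable_swap.aemeasurable
    have hK1 : ∀ᵐ p ∂γ, (K p).fst = κ.step t' p.1 := hsC.mono fun p hp => hp.1.1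
    have hK2 : ∀ᵐ p ∂γ.map Prod.swap, (swapKernel K p).fst = η.step t' p.1 := by
      -- The swap is a measurable equivalence, so no measurability of the event is required.
      refine MeasurableEquiv.prodComm.measurableEmbedding.ae_map_iff.2 ?_
      refine hsC.mono fun p hp => ?_
      rw [swapKernel_fst]
      exact hp.1.2
    refine ⟨glue γ K, inferInstance, fst_glue (t := t') κ hfst hK1, ?_, fun r hr => ?_, ?_⟩
    · rw [← Measure.fst_map_swap, glue_map_swap]
      exact fst_glue (t := t') η (by rw [Measure.fst_map_swap, hsnd]) hK2
    · rw [glue_map_swap]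
      rcases Nat.lt_succ_iff_lt_or_eq.1 hr with h | h
      · exact ⟨(hstep r h).1.glue (t := t') κ, (hstep r h).2.glue (t := t') η⟩
      · obtain rfl : r = t' := Fin.ext h
        exact ⟨stepCausal_glue (t := t') κ hK1, stepCausal_glue (t := t') η hK2⟩
    · have hV := (lowerSemianalytic_costFn κ η hc (t + 1) ht).aemeasurable (glue γ K)
      have hV' := (lowerSemianalytic_costFn_snoc κ η hc t').aemeasurable (γ ⊗ₘ K)
      calc ∫⁻ ω, costFn κ η c (t + 1) ht ω.1 ω.2 ∂(glue γ K)
          = ∫⁻ p, ∫⁻ q, costFn κ η c (t + 1) ht (snocPath p.1 q.1) (snocPath p.2 q.2)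
              ∂(K p) ∂γ := by
            rw [glue, lintegral_map' hV measurable_snocPath_histories.aemeasurable]
            exact lintegral_compProd_of_aemeasurable hV'
        _ ≤ ∫⁻ p, (costFn κ η c t (Nat.le_of_succ_le ht) p.1 p.2 + ε) ∂γ := by
            refine lintegral_mono_ae ?_
            filter_upwards [hsC] with p hp
            rw [show costFn κ η c t (Nat.le_of_succ_le ht) p.1 p.2 = _ from
              costFn_of_lt κ η c t' p.1 p.2]
            exact hp.2
        _ ≤ costFn κ η c 0 N.zero_le Fin.elim0 Fin.elim0 + t * ε + ε := by
            rw [lintegral_add_right _ measurable_const]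
            simpa using add_le_add_left hcost ε
        _ = _ := by push_cast; ring

theorem exists_near_optimal_bicausal [IsProbabilityMeasure μ] [IsProbabilityMeasure ν]
    {c : (Fin N → ℝ) × (Fin N → ℝ) → ℝ≥0∞} (hc : Measurable c) {ε : ℝ≥0∞} (hε : ε ≠ 0) :
    ∃ γ ∈ bicausalPlans μ ν, ∫⁻ ω, c ω ∂(γ : Measure ((Fin N → ℝ) × (Fin N → ℝ)))
        ≤ costFn κ η c 0 N.zero_le Fin.elim0 Fin.elim0 + N * ε := by
  obtain ⟨γ, hγ, hfst, hsnd, hstep, hcost⟩ := exists_near_optimal_prefix κ η hc hε N le_rfl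
  rw [head_rfl, Measure.map_id] at hfst hsnd
  refine ⟨⟨γ, hγ⟩, (mem_bicausalPlans_iff κ η).2 ⟨⟨hfst, hsnd⟩, fun t => hstep t t.isLt⟩, ?_⟩
  refine le_of_eq_of_le (lintegral_congr fun ω => ?_) hcost
  exact (costFn_last κ η c ω.1 ω.2).symm

/-- The dynamic programming principle for costs with values in `[0, ∞]`. -/
theorem costFn_zero_eq_iInf [IsProbabilityMeasure μ] [IsProbabilityMeasure ν]
    {c : (Fin N → ℝ) × (Fin N → ℝ) → ℝ≥0∞} (hc : Measurable c) :
    costFn κ η c 0 N.zero_le Fin.elim0 Fin.elim0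
      = ⨅ γ ∈ bicausalPlans μ ν, ∫⁻ ω, c ω ∂(γ : Measure ((Fin N → ℝ) × (Fin N → ℝ))) := by
  refine le_antisymm (le_iInf₂ fun γ hγ => costFn_zero_le_lintegral κ η hc hγ) ?_
  refine ENNReal.le_of_forall_pos_le_add fun ε hε _ => ?_
  -- The divisor `N + 1` keeps the quotient meaningful for `N = 0` as well.
  have hN : (ε : ℝ≥0∞) / (N + 1) ≠ 0 :=
    (ENNReal.div_pos (coe_ne_zero.2 hε.ne') (by finiteness)).ne'
  obtain ⟨γ, hγ, hle⟩ := exists_near_optimal_bicausal κ η hc hN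
  refine (iInf₂_le γ hγ).trans (hle.trans (add_le_add_right ?_ _))
  calc (N : ℝ≥0∞) * (ε / (N + 1)) ≤ (N + 1) * (ε / (N + 1)) := by gcongr; exact le_self_add
    _ = ε := ENNReal.mul_div_cancel (by simp) (by finiteness)

end Gluing

/-! ### The dynamic programming principle for costs that are bounded from below -/

section DynamicProgramming

variable {N : ℕ} {μ ν : Measure (Fin N → ℝ)}

theorem exists_eq_coe_sub {α : Type*} [MeasurableSpace α] {c : α → EReal} (hc : Measurable c)
    (hbdd : ∃ m : ℝ, ∀ p, (m : EReal) ≤ c p) :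
    ∃ (f : α → ℝ≥0∞) (b : NNReal), Measurable f ∧
      c = fun p => (f p : EReal) - ((b : ℝ≥0∞) : EReal) := by
  obtain ⟨m, hm⟩ := hbdd
  let b := (-m).toNNReal
  refine ⟨fun p => (c p + ((b : ℝ≥0∞) : EReal)).toENNReal, b,
    (hc.add measurable_const).ereal_toENNReal, funext fun p => ?_⟩
  refine (coe_toENNReal_add_sub (le_trans ?_ (hm p))).symm
  rw [EReal.coe_nnreal_eq_coe_real, ← EReal.coe_neg, EReal.coe_le_coe_iff, neg_le]
  exact Real.le_coe_toNNReal _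

/-- There is only one history of length `0`, so the almost sure identity defining a version holds at
that very point. -/
theorem RegularKernels.step_zero (κ : RegularKernels μ) [IsProbabilityMeasure μ] (hN : 0 < N) :
    κ.step ⟨0, hN⟩ Fin.elim0 = μ.map fun x => x ⟨0, hN⟩ := by
  have h := congrArg Measure.snd (map_head_compProd_stepKernel κ ⟨0, hN⟩)
  rw [Measure.snd_map_prodMk (measurable_head _)] at h
  have : IsProbabilityMeasure (μ.map (head (N := N) hN.le)) :=
    Measure.isProbabilityMeasure_map (measurable_head _).aemeasurable
  have hK : ∀ t : Fin N, IsMarkovKernel (κ.stepKernel t) := fun _ => inferInstance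
  have := hK ⟨0, hN⟩
  rw [← h]
  ext F hF
  rw [Measure.snd_apply hF, Measure.compProd_apply (measurable_snd hF)]
  have : ∀ x : Fin 0 → ℝ, κ.stepKernel ⟨0, hN⟩ x (Prod.mk x ⁻¹' (Prod.snd ⁻¹' F))
      = κ.step ⟨0, hN⟩ Fin.elim0 F := fun x => by
    rw [Subsingleton.elim (α := Fin 0 → ℝ) x Fin.elim0, ← κ.stepKernel_apply]; rfl
  refine Eq.symm ((lintegral_congr this).trans ?_)
  simp

theorem valueFn_coe_sub (κ : RegularKernels μ) (η : RegularKernels ν)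
    {c : (Fin N → ℝ) × (Fin N → ℝ) → ℝ≥0∞} (hc : Measurable c) (b : NNReal)
    (t : ℕ) (ht : t ≤ N) (x y : Fin t → ℝ) :
    valueFn κ η (fun p => (c p : EReal) - ((b : ℝ≥0∞) : EReal)) t ht x y
      = (costFn κ η c t ht x y : EReal) - ((b : ℝ≥0∞) : EReal) :=
  nestedValue_eq_nestedCost_sub κ η hc b _ _ _ x y

theorem hasExtIntegral_valueFn (κ : RegularKernels μ) (η : RegularKernels ν)
    {c : (Fin N → ℝ) × (Fin N → ℝ) → EReal} (hc : Measurable c)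
    (hbdd : ∃ m : ℝ, ∀ p, (m : EReal) ≤ c p) {t : ℕ} (ht : t + 1 ≤ N) (x y : Fin t → ℝ)
    (γ : Measure (ℝ × ℝ)) [IsProbabilityMeasure γ] :
    HasExtIntegral γ fun p => valueFn κ η c (t + 1) ht (snocPath x p.1) (snocPath y p.2) := by
  obtain ⟨f, b, hf, rfl⟩ := exists_eq_coe_sub hc hbdd
  simp only [valueFn_coe_sub κ η hf b]
  exact hasExtIntegral_coe_sub (aemeasurable_nestedCost_snoc κ η hf _ x y γ)

theorem bicausalValue_coe_sub {c : (Fin N → ℝ) × (Fin N → ℝ) → ℝ≥0∞} (hc : Measurable c)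
    (b : NNReal) :
    bicausalValue μ ν (fun p => (c p : EReal) - ((b : ℝ≥0∞) : EReal))
      = ((⨅ γ ∈ bicausalPlans μ ν, ∫⁻ ω, c ω ∂(γ : Measure ((Fin N → ℝ) × (Fin N → ℝ))) : ℝ≥0∞) :
        EReal) - ((b : ℝ≥0∞) : EReal) := by
  simp only [bicausalValue, ← iInf_coe_sub]
  exact iInf_congr fun γ => iInf_congr fun _ => extIntegral_coe_sub hc.aemeasurable

theorem dynValue_eq_bicausalValue [IsProbabilityMeasure μ] [IsProbabilityMeasure ν]
    (κ : RegularKernels μ) (η : RegularKernels ν)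
    {c : (Fin N → ℝ) × (Fin N → ℝ) → EReal} (hc : Measurable c)
    (hbdd : ∃ m : ℝ, ∀ p, (m : EReal) ≤ c p) : dynValue κ η c = bicausalValue μ ν c := by
  obtain ⟨f, b, hf, rfl⟩ := exists_eq_coe_sub hc hbdd
  rw [bicausalValue_coe_sub hf, ← costFn_zero_eq_iInf κ η hf, ← valueFn_coe_sub κ η hf]
  exact nestedValue_congr κ η _ (Nat.sub_zero N).symm _ _ _ _

theorem snocPath_elim0 (a : ℝ) : snocPath (Fin.elim0 : Fin 0 → ℝ) a = fun _ => a := by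
  funext i
  obtain rfl : i = Fin.last 0 := Fin.fin_one_eq_zero i
  exact Fin.snoc_last (α := fun _ => ℝ) _ _

theorem valueZero_eq_dynValue [IsProbabilityMeasure μ] [IsProbabilityMeasure ν] (hN : 1 ≤ N)
    (κ : RegularKernels μ) (η : RegularKernels ν) (c : (Fin N → ℝ) × (Fin N → ℝ) → EReal) :
    valueZero hN κ η c = dynValue κ η c := by
  refine Eq.trans ?_ ((valueFn_of_lt κ η c ⟨0, hN⟩ Fin.elim0 Fin.elim0).symm.trans
    (nestedValue_congr κ η _ (Nat.sub_zero N) _ _ _ _))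
  rw [κ.step_zero, η.step_zero]
  simp only [valueZero, snocPath_elim0]

end DynamicProgramming

/-! ### Semicontinuity of integrals with respect to weak convergence -/

section Semicontinuity

variable {X : Type*} [TopologicalSpace X]

theorem lowerSemicontinuousOn_congr {f g : X → ℝ≥0∞} {A : Set X} (h : EqOn f g A) :
    LowerSemicontinuousOn f A ↔ LowerSemicontinuousOn g A := by
  have : ∀ {f g : X → ℝ≥0∞}, EqOn f g A → LowerSemicontinuousOn f A →
      LowerSemicontinuousOn g A := by
    intro f g h hf x hx a ha
    filter_upwards [hf x hx a (ha.trans_eq (h hx).symm), self_mem_nhdsWithin] with y hy hyA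
    exact hy.trans_eq (h hyA)
  exact ⟨this h, this h.symm⟩

/-- The extension is the lower semicontinuous envelope relative to `A`. It lets results on globally
semicontinuous integrands apply to measures concentrated on `A`. -/
theorem exists_lowerSemicontinuous_eqOn {f : X → ℝ≥0∞} {A : Set X}
    (hf : LowerSemicontinuousOn f A) : ∃ g : X → ℝ≥0∞, LowerSemicontinuous g ∧ EqOn f g A := by
  refine ⟨fun x => ⨆ U : {U : Set X // IsOpen U ∧ x ∈ U}, ⨅ y ∈ U.1 ∩ A, f y,
    fun x a ha => ?_, fun x hx => le_antisymm ?_ ?_⟩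
  · obtain ⟨⟨U, hU, hxU⟩, h⟩ := lt_iSup_iff.1 ha
    filter_upwards [hU.mem_nhds hxU] with y hy
    exact lt_iSup_iff.2 ⟨⟨U, hU, hy⟩, h⟩
  · refine le_of_forall_lt fun a ha => ?_
    obtain ⟨a', haa', ha'⟩ := exists_between ha
    obtain ⟨U, hU, hxU, hUA⟩ := mem_nhdsWithin.1 (hf x hx a' ha')
    exact haa'.trans_le (le_iSup_of_le ⟨U, hU, hxU⟩ (le_iInf₂ fun y hy => (hUA hy).le))
  · exact iSup_le fun U => iInf₂_le x ⟨U.2.2, hx⟩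

variable [MeasurableSpace X] [BorelSpace X]

theorem lowerSemicontinuous_lintegral [TopologicalSpace.PseudoMetrizableSpace X]
    [TopologicalSpace.SeparableSpace X] {f : X → ℝ≥0∞} (hf : LowerSemicontinuous f) :
    LowerSemicontinuous fun γ : ProbabilityMeasure X => ∫⁻ x, f x ∂(γ : Measure X) := by
  intro γ a ha
  by_contra h
  -- Sequences suffice, since the weak topology has countably generated neighbourhood filters here.
  obtain ⟨γs, hγs, hle⟩ := exists_seq_forall_of_frequently (not_eventually.1 h)
  have h1 := lintegral_le_liminf_of_lowerSemicontinuous (γ := (γ : Measure X))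
    (γs := fun n => (γs n : Measure X)) hf
    fun G hG => ProbabilityMeasure.le_liminf_measure_open_of_tendsto hγs hG
  refine absurd (ha.trans_le h1) (not_lt.2 ?_)
  refine liminf_le_of_le (by isBoundedDefault) fun b hb => ?_
  obtain ⟨n, hn⟩ := hb.exists
  exact hn.trans (not_lt.1 (hle n))

theorem lowerSemicontinuousOn_lintegral [TopologicalSpace.PseudoMetrizableSpace X]
    [TopologicalSpace.SeparableSpace X] {f : X → ℝ≥0∞} {A : Set X}
    (hf : LowerSemicontinuousOn f A) {C : Set (ProbabilityMeasure X)}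
    (hC : ∀ γ ∈ C, ∀ᵐ x ∂(γ : Measure X), x ∈ A) :
    LowerSemicontinuousOn (fun γ : ProbabilityMeasure X => ∫⁻ x, f x ∂(γ : Measure X)) C := by
  obtain ⟨g, hg, hfg⟩ := exists_lowerSemicontinuous_eqOn hf
  refine (lowerSemicontinuousOn_congr fun γ hγ => ?_).2
    ((lowerSemicontinuous_lintegral hg).lowerSemicontinuousOn C)
  exact lintegral_congr_ae ((hC γ hγ).mono fun x hx => hfg hx)

end Semicontinuity

/-! ### Compactness of sets of couplings -/

section Compactness

theorem mem_couplings_iff {X Y : Type*} [MeasurableSpace X] [MeasurableSpace Y]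
    {p : ProbabilityMeasure X} {q : ProbabilityMeasure Y} {γ : ProbabilityMeasure (X × Y)} :
    γ ∈ couplings (p : Measure X) (q : Measure Y) ↔ γ.map measurable_fst.aemeasurable = p ∧
      γ.map measurable_snd.aemeasurable = q :=
  ⟨fun h => ⟨Subtype.ext h.1, Subtype.ext h.2⟩,
    fun h => ⟨congrArg Subtype.val h.1, congrArg Subtype.val h.2⟩⟩

variable {X Y : Type*} [TopologicalSpace X] [PolishSpace X] [MeasurableSpace X] [BorelSpace X]
  [TopologicalSpace Y] [PolishSpace Y] [MeasurableSpace Y] [BorelSpace Y]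

theorem isTightMeasureSet_of_isCompact {S : Set (ProbabilityMeasure X)} (hS : IsCompact S) :
    IsTightMeasureSet {((μ : ProbabilityMeasure X) : Measure X) | μ ∈ S} := by
  let := TopologicalSpace.upgradeIsCompletelyMetrizable X
  exact isTightMeasureSet_of_isCompact_closure hS.closure

/-- Prokhorov's theorem: tight families of marginals force tightness of the joint laws, and the
marginal maps are continuous. -/
theorem isCompact_setOf_marginals {S : Set (ProbabilityMeasure X)} {T : Set (ProbabilityMeasure Y)}
    (hS : IsCompact S) (hT : IsCompact T) :
    IsCompact {γ : ProbabilityMeasure (X × Y) | γ.map measurable_fst.aemeasurable ∈ S ∧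
      γ.map measurable_snd.aemeasurable ∈ T} := by
  refine IsCompact.of_isClosed_subset (isCompact_closure_of_isTightMeasureSet ?_) ?_
    subset_closure
  · refine IsTightMeasureSet.prodMk
      ((isTightMeasureSet_of_isCompact hS).subset ?_)
      ((isTightMeasureSet_of_isCompact hT).subset ?_)
    · rintro _ ⟨_, ⟨γ, hγ, rfl⟩, rfl⟩
      exact ⟨_, hγ.1, rfl⟩
    · rintro _ ⟨_, ⟨γ, hγ, rfl⟩, rfl⟩
      exact ⟨_, hγ.2, rfl⟩
  · exact (hS.isClosed.preimage (ProbabilityMeasure.continuous_map continuous_fst)).inter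
      (hT.isClosed.preimage (ProbabilityMeasure.continuous_map continuous_snd))

theorem isCompact_couplings (p : Measure X) (q : Measure Y) [IsProbabilityMeasure p]
    [IsProbabilityMeasure q] : IsCompact (couplings p q) := by
  convert isCompact_setOf_marginals (isCompact_singleton (x := (⟨p, ‹_›⟩ : ProbabilityMeasure X)))
    (isCompact_singleton (x := (⟨q, ‹_›⟩ : ProbabilityMeasure Y))) using 1
  ext γ
  exact mem_couplings_iff (p := ⟨p, ‹_›⟩) (q := ⟨q, ‹_›⟩)

/-- Couplings of weakly convergent sequences subconverge to a coupling of the limits. -/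
theorem exists_tendsto_subseq_couplings {p : ℕ → ProbabilityMeasure X} {p₀ : ProbabilityMeasure X}
    {q : ℕ → ProbabilityMeasure Y} {q₀ : ProbabilityMeasure Y} (hp : Tendsto p atTop (𝓝 p₀))
    (hq : Tendsto q atTop (𝓝 q₀)) {γ : ℕ → ProbabilityMeasure (X × Y)}
    (hγ : ∀ n, γ n ∈ couplings (p n : Measure X) (q n : Measure Y)) :
    ∃ γ₀ ∈ couplings (p₀ : Measure X) (q₀ : Measure Y), ∃ φ : ℕ → ℕ, StrictMono φ ∧
      Tendsto (γ ∘ φ) atTop (𝓝 γ₀) := by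
  obtain ⟨γ₀, -, φ, hφ, hlim⟩ := (isCompact_setOf_marginals hp.isCompact_insert_range
    hq.isCompact_insert_range).tendsto_subseq (x := γ) fun n =>
      ⟨Or.inr ⟨n, (mem_couplings_iff.1 (hγ n)).1.symm⟩,
        Or.inr ⟨n, (mem_couplings_iff.1 (hγ n)).2.symm⟩⟩
  refine ⟨γ₀, mem_couplings_iff.2 ⟨?_, ?_⟩, φ, hφ, hlim⟩
  · refine tendsto_nhds_unique
      (ProbabilityMeasure.tendsto_map_of_tendsto_of_continuous _ _ hlim continuous_fst)
      ((hp.comp hφ.tendsto_atTop).congr fun n => ?_)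
    exact (mem_couplings_iff.1 (hγ (φ n))).1.symm
  · refine tendsto_nhds_unique
      (ProbabilityMeasure.tendsto_map_of_tendsto_of_continuous _ _ hlim continuous_snd)
      ((hq.comp hφ.tendsto_atTop).congr fun n => ?_)
    exact (mem_couplings_iff.1 (hγ (φ n))).2.symm

/-- Along a sequence violating semicontinuity, nearly optimal couplings subconverge to a coupling of
the limit marginals. Tensoring them with Dirac masses at the parameters turns the varying integrands
`f (z, ·)` into the single function `f`. -/
theorem lowerSemicontinuousOn_iInf_lintegral_couplings {Z : Type*} [TopologicalSpace Z]
    [PolishSpace Z] [MeasurableSpace Z] [BorelSpace Z] {D : Set Z}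
    {p : Z → ProbabilityMeasure X} {q : Z → ProbabilityMeasure Y} (hp : ContinuousOn p D)
    (hq : ContinuousOn q D) {f : Z × (X × Y) → ℝ≥0∞} (hf : LowerSemicontinuous f) :
    LowerSemicontinuousOn (fun z => ⨅ γ ∈ couplings (p z : Measure X) (q z : Measure Y),
      ∫⁻ r, f (z, r) ∂(γ : Measure (X × Y))) D := by
  intro z hz a ha
  by_contra h
  obtain ⟨a', haa', ha'⟩ := exists_between ha
  obtain ⟨zs, hzs, hle⟩ := exists_seq_forall_of_frequently (not_eventually.1 h)
  have hex : ∀ n, ∃ γ ∈ couplings (p (zs n) : Measure X) (q (zs n) : Measure Y),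
      ∫⁻ r, f (zs n, r) ∂(γ : Measure (X × Y)) < a' := fun n => by
    have := (not_lt.1 (hle n)).trans_lt haa'
    simpa only [iInf_lt_iff, exists_prop] using this
  choose γ hγ hγa using hex
  obtain ⟨γ₀, hγ₀, φ, hφ, hlim⟩ :=
    exists_tendsto_subseq_couplings ((hp z hz).tendsto.comp hzs) ((hq z hz).tendsto.comp hzs) hγ
  have hint : ∀ (z : Z) (γ : ProbabilityMeasure (X × Y)),
      ∫⁻ w, f w ∂((diracProba z).prod γ : ProbabilityMeasure (Z × (X × Y)))
        = ∫⁻ r, f (z, r) ∂(γ : Measure (X × Y)) := fun z γ => by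
    have : ((diracProba z).prod γ : Measure (Z × (X × Y)))
        = (Measure.dirac z).prod (γ : Measure (X × Y)) := rfl
    rw [this, lintegral_prod _ hf.measurable.aemeasurable, lintegral_dirac]
  have hz' : Tendsto (fun n => zs (φ n)) atTop (𝓝 z) :=
    (tendsto_nhdsWithin_iff.1 hzs).1.comp hφ.tendsto_atTop
  have hlim' : Tendsto (fun n => (diracProba (zs (φ n))).prod (γ (φ n))) atTop
      (𝓝 ((diracProba z).prod γ₀)) :=
    (ProbabilityMeasure.continuous_prod.tendsto (diracProba z, γ₀)).comp
      (((continuous_diracProba.tendsto z).comp hz').prodMk_nhds hlim)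
  have h1 := hlim'.eventually (lowerSemicontinuous_lintegral hf ((diracProba z).prod γ₀) a'
    ((ha'.trans_le (iInf₂_le γ₀ hγ₀)).trans_eq (hint z γ₀).symm))
  obtain ⟨n, hn⟩ := h1.exists
  exact lt_asymm (hn.trans_eq (hint _ _)) (hγa (φ n))

end Compactness

/-! ### Conditional laws along the support -/

section Support

variable {N : ℕ} {μ : Measure (Fin N → ℝ)}

@[fun_prop]
theorem continuous_head {t : ℕ} (ht : t ≤ N) : Continuous (head ht) :=
  continuous_pi fun _ => continuous_apply _

@[fun_prop]
theorem continuous_snocPath {α : Type*} [TopologicalSpace α] {t : ℕ} {f : α → Fin t → ℝ}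
    {g : α → ℝ} (hf : Continuous f) (hg : Continuous g) :
    Continuous fun a => snocPath (f a) (g a) := by
  refine continuous_pi fun i => ?_
  refine Fin.lastCases ?_ (fun j => ?_) i
  · simpa [snocPath] using hg
  · simp only [snocPath, Fin.snoc_castSucc]
    exact (continuous_apply j).comp hf

theorem measurableSet_supportHead {t : ℕ} (ht : t ≤ N) (μ : Measure (Fin N → ℝ)) :
    MeasurableSet (supportHead ht μ) := by
  rw [supportHead, ← inter_univ μ.support, ← iUnion_compactCovering, inter_iUnion, image_iUnion]
  refine MeasurableSet.iUnion fun n => IsCompact.measurableSet ?_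
  exact ((isCompact_compactCovering _ n).inter_left μ.isClosed_support).image (continuous_head ht)

theorem ae_mem_support (μ : Measure (Fin N → ℝ)) : ∀ᵐ x ∂μ, x ∈ μ.support :=
  Measure.support_mem_ae

theorem ae_head_mem_supportHead {t : ℕ} (ht : t ≤ N) (μ : Measure (Fin N → ℝ)) :
    ∀ᵐ x ∂μ, head ht x ∈ supportHead ht μ :=
  (ae_mem_support μ).mono fun _ hx => mem_image_of_mem _ hx

/-- Neighbourhoods of a projected support point have positive mass and so meet every almost sure
event. This extends almost sure statements about histories to all of the projected support by
continuity. -/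
theorem supportHead_subset_closure {t : ℕ} (ht : t ≤ N) {P : (Fin t → ℝ) → Prop}
    (hP : ∀ᵐ x ∂μ, P (head ht x)) :
    supportHead ht μ ⊆ closure {x ∈ supportHead ht μ | P x} := by
  rintro _ ⟨ω, hω, rfl⟩
  refine mem_closure_iff_nhds.2 fun U hU => ?_
  have hpos := (Measure.mem_support_iff_forall _).1 hω _ ((continuous_head ht).continuousAt hU)
  have h : ∃ᶠ x in ae μ, x ∈ head ht ⁻¹' U := by
    rw [frequently_ae_mem_iff]; exact hpos.ne'
  obtain ⟨x, hxU, hx, hxP⟩ := (h.and_eventually ((ae_head_mem_supportHead ht μ).and hP)).exists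
  exact ⟨head ht x, hxU, hx, hxP⟩

/-- The path obtained by prolonging the history `x` of length `t` by `z`. -/
def joinPath {t : ℕ} (p : (Fin t → ℝ) × (Fin (N - t) → ℝ)) : Fin N → ℝ :=
  fun i => if h : (i : ℕ) < t then p.1 ⟨i, h⟩ else p.2 ⟨i - t, by omega⟩

theorem continuous_joinPath {t : ℕ} : Continuous (joinPath (N := N) (t := t)) := by
  refine continuous_pi fun i => ?_
  by_cases h : (i : ℕ) < t
  · simp only [joinPath, h, dif_pos]; fun_prop
  · simp only [joinPath, h, dif_neg, not_false_iff]; fun_prop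

theorem joinPath_head_tail {t : ℕ} (ht : t ≤ N) (x : Fin N → ℝ) :
    joinPath (head ht x, tail t x) = x := by
  ext i
  by_cases h : (i : ℕ) < t
  · simp [joinPath, h, head]
  · simp only [joinPath, h, dif_neg, not_false_iff, tail]
    congr 1
    ext
    simp only
    omega

theorem head_succ_joinPath {t : ℕ} (ht : t < N) (x : Fin t → ℝ) (z : Fin (N - t) → ℝ) :
    head (Nat.succ_le_of_lt ht) (joinPath (x, z)) = snocPath x (z ⟨0, Nat.sub_pos_of_lt ht⟩) := by
  ext i
  refine Fin.lastCases ?_ (fun j => ?_) i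
  · simp [head, joinPath, snocPath]
  · simp [head, joinPath, snocPath]

/-- For almost every history this is the disintegration of `μ`. The mass that the prolonged law `Φ
x` gives to the open complement of the support is lower semicontinuous in `x`; if positive at one
history, it would be positive nearby, contradicting density of the histories where it vanishes. -/
theorem RegularKernels.WeaklyContinuous.ae_joinPath_mem_support [IsProbabilityMeasure μ]
    {κ : RegularKernels μ} (hκ : κ.WeaklyContinuous) (t : Fin N) {x : Fin t → ℝ}
    (hx : x ∈ supportHead t.isLt.le μ) : ∀ᵐ z ∂κ.ker t x, joinPath (x, z) ∈ μ.support := by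
  have := κ.markov t
  have hO : IsOpen μ.supportᶜ := μ.isClosed_support.isOpen_compl
  let Φ : (Fin t → ℝ) → ProbabilityMeasure (Fin N → ℝ) := fun x =>
    ((diracProba x).prod (κ.law t x)).map continuous_joinPath.measurable.aemeasurable
  have hΦ : ∀ x, (Φ x : Measure (Fin N → ℝ)) μ.supportᶜ
      = κ.ker t x {z | joinPath (x, z) ∉ μ.support} := fun x => by
    have : (Φ x : Measure (Fin N → ℝ))
        = ((Measure.dirac x).prod (κ.ker t x)).map joinPath := rfl
    rw [this, Measure.map_apply continuous_joinPath.measurable hO.measurableSet,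
      Measure.prod_apply (continuous_joinPath.measurable hO.measurableSet), lintegral_dirac]
    rfl
  have hcont : ContinuousOn Φ (supportHead t.isLt.le μ) :=
    (ProbabilityMeasure.continuous_map continuous_joinPath).comp_continuousOn
      (ProbabilityMeasure.continuous_prod.comp_continuousOn
        (continuous_diracProba.continuousOn.prodMk (hκ t)))
  have hae : ∀ᵐ x ∂μ, (Φ (head t.isLt.le x) : Measure (Fin N → ℝ)) μ.supportᶜ = 0 := by
    have h1 : ∀ᵐ p ∂(μ.map (head t.isLt.le) ⊗ₘ κ.ker t), joinPath p ∈ μ.support := by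
      rw [κ.disintegrates, ae_map_iff ((measurable_head _).prodMk (measurable_tail _)).aemeasurable
        (continuous_joinPath.measurable μ.isClosed_support.measurableSet)]
      refine (ae_mem_support μ).mono fun x hx => ?_
      rwa [joinPath_head_tail]
    refine (ae_of_ae_map (measurable_head _).aemeasurable
      (Measure.ae_ae_of_ae_compProd h1)).mono fun x hx => ?_
    rw [hΦ]
    exact hx
  by_contra hne
  have hpos : 0 < (Φ x : Measure (Fin N → ℝ)) μ.supportᶜ := by
    rw [hΦ]
    exact pos_iff_ne_zero.2 hne
  have hev : ∀ᶠ y in 𝓝[supportHead t.isLt.le μ] x, 0 < (Φ y : Measure (Fin N → ℝ)) μ.supportᶜ :=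
    (hcont x hx).eventually (lowerSemicontinuous_measure_of_isOpen hO (Φ x) 0 hpos)
  obtain ⟨U, hU, hxU, hUS⟩ := mem_nhdsWithin.1 hev
  obtain ⟨y, hyU, hy, hy0⟩ := mem_closure_iff.1 (supportHead_subset_closure (P := fun x =>
    (Φ x : Measure (Fin N → ℝ)) μ.supportᶜ = 0) t.isLt.le hae hx) U hU hxU
  exact (hUS ⟨hyU, hy⟩).ne' hy0

theorem RegularKernels.WeaklyContinuous.ae_snocPath_mem_supportHead [IsProbabilityMeasure μ]
    {κ : RegularKernels μ} (hκ : κ.WeaklyContinuous) (t : Fin N) {x : Fin t → ℝ}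
    (hx : x ∈ supportHead t.isLt.le μ) :
    ∀ᵐ a ∂κ.step t x, snocPath x a ∈ supportHead (Nat.succ_le_of_lt t.isLt) μ := by
  rw [RegularKernels.step, ae_map_iff (Measurable.aemeasurable (by fun_prop))
    ((by fun_prop : Measurable fun a => snocPath x a) (measurableSet_supportHead _ μ))]
  refine (hκ.ae_joinPath_mem_support t hx).mono fun z hz => ?_
  beta_reduce
  rw [← head_succ_joinPath t.isLt]
  exact mem_image_of_mem _ hz

/-- The conditional law of the next coordinate as an element of the space of probability
measures. -/
noncomputable def RegularKernels.stepLaw (κ : RegularKernels μ) (t : Fin N) (x : Fin t → ℝ) :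
    ProbabilityMeasure ℝ :=
  ⟨κ.step t x, inferInstance⟩

theorem RegularKernels.WeaklyContinuous.continuousOn_stepLaw {κ : RegularKernels μ}
    (hκ : κ.WeaklyContinuous) (t : Fin N) :
    ContinuousOn (κ.stepLaw t) (supportHead t.isLt.le μ) :=
  (ProbabilityMeasure.continuous_map
    (continuous_apply (⟨0, Nat.sub_pos_of_lt t.isLt⟩ : Fin (N - t)))).comp_continuousOn (hκ t)

end Support

/-! ### Bicausal plans form a compact set -/

section Compactness

variable {N : ℕ} {μ ν : Measure (Fin N → ℝ)}

theorem ae_mem_support_prod {γ : ProbabilityMeasure ((Fin N → ℝ) × (Fin N → ℝ))}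
    (hγ : γ ∈ couplings μ ν) : ∀ᵐ ω ∂(γ : Measure ((Fin N → ℝ) × (Fin N → ℝ))),
      ω ∈ μ.support ×ˢ ν.support := by
  have h1 : ∀ᵐ x ∂(γ : Measure ((Fin N → ℝ) × (Fin N → ℝ))).fst, x ∈ μ.support := by
    rw [hγ.1]; exact ae_mem_support _
  have h2 : ∀ᵐ x ∂(γ : Measure ((Fin N → ℝ) × (Fin N → ℝ))).snd, x ∈ ν.support := by
    rw [hγ.2]; exact ae_mem_support _
  filter_upwards [ae_of_ae_map measurable_fst.aemeasurable h1,
    ae_of_ae_map measurable_snd.aemeasurable h2] with ω hω1 hω2 using ⟨hω1, hω2⟩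

variable [IsProbabilityMeasure μ] [IsProbabilityMeasure ν]

theorem continuous_histories {n t : ℕ} (ht : t ≤ n) : Continuous (histories ht) := by
  unfold histories; fun_prop

/-- One-step causality equates two laws depending continuously on the coupling. For `Λ` this is the
portmanteau criterion: the mass of an open set is the integral of a function that is semicontinuous
over `supp μ`, where every coupling with first marginal `μ` is concentrated. -/
theorem RegularKernels.WeaklyContinuous.isClosed_setOf_stepCausal {κ : RegularKernels μ}
    (hκ : κ.WeaklyContinuous) (t : Fin N) :
    IsClosed {γ : ProbabilityMeasure ((Fin N → ℝ) × (Fin N → ℝ)) | γ ∈ couplings μ ν ∧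
      StepCausal κ (γ : Measure ((Fin N → ℝ) × (Fin N → ℝ))) t t.isLt} := by
  let K : Kernel ((Fin t → ℝ) × (Fin t → ℝ)) ℝ := (κ.stepKernel t).comap Prod.fst measurable_fst
  have hΛ : ∀ γ : ProbabilityMeasure ((Fin N → ℝ) × (Fin N → ℝ)), IsProbabilityMeasure
      ((γ : Measure ((Fin N → ℝ) × (Fin N → ℝ))).map (histories t.isLt.le) ⊗ₘ K) := fun γ => by
    have := Measure.isProbabilityMeasure_map (μ := (γ : Measure ((Fin N → ℝ) × (Fin N → ℝ))))
      (measurable_histories t.isLt.le).aemeasurable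
    infer_instance
  let Λ : ProbabilityMeasure ((Fin N → ℝ) × (Fin N → ℝ)) →
      ProbabilityMeasure (((Fin t → ℝ) × (Fin t → ℝ)) × ℝ) := fun γ => ⟨_, hΛ γ⟩
  have hm : Continuous fun ω : (Fin N → ℝ) × (Fin N → ℝ) => (histories t.isLt.le ω, ω.1 t) :=
    (continuous_histories _).prodMk ((continuous_apply t).comp continuous_fst)
  have hcl : IsClosed (couplings μ ν) := (isCompact_couplings μ ν).isClosed
  have hΛc : ContinuousOn Λ (couplings μ ν) := by
    intro γ hγ
    refine tendsto_of_forall_isOpen_le_liminf' fun G hG => ?_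
    let f : (Fin t → ℝ) × (Fin t → ℝ) → ℝ≥0∞ := fun p =>
      ((diracProba p).prod (κ.stepLaw t p.1) : Measure (((Fin t → ℝ) × (Fin t → ℝ)) × ℝ)) G
    have hfK : ∀ p, f p = K p (Prod.mk p ⁻¹' G) := fun p => by
      have : f p = ((Measure.dirac p).prod (κ.step t p.1)) G := rfl
      rw [this, Measure.prod_apply hG.measurableSet, lintegral_dirac, Kernel.comap_apply,
        κ.stepKernel_apply]
    have hf : LowerSemicontinuousOn (fun ω => f (histories t.isLt.le ω))
        (μ.support ×ˢ (univ : Set (Fin N → ℝ))) := by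
      have hc : ContinuousOn (fun p : (Fin t → ℝ) × (Fin t → ℝ) =>
          (diracProba p).prod (κ.stepLaw t p.1)) (supportHead t.isLt.le μ ×ˢ univ) :=
        ProbabilityMeasure.continuous_prod.comp_continuousOn
          (continuous_diracProba.continuousOn.prodMk
            ((hκ.continuousOn_stepLaw t).comp continuousOn_fst fun p hp => hp.1))
      exact ((lowerSemicontinuous_measure_of_isOpen hG).lowerSemicontinuousOn univ).comp
        (hc.comp (continuous_histories _).continuousOn
          fun ω hω => ⟨mem_image_of_mem _ hω.1, mem_univ _⟩) fun _ _ => mem_univ _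
    have hint : ∀ γ, (Λ γ : Measure (((Fin t → ℝ) × (Fin t → ℝ)) × ℝ)) G
        = ∫⁻ ω, f (histories t.isLt.le ω) ∂(γ : Measure ((Fin N → ℝ) × (Fin N → ℝ))) := fun γ => by
      have : (Λ γ : Measure (((Fin t → ℝ) × (Fin t → ℝ)) × ℝ))
        = (γ : Measure ((Fin N → ℝ) × (Fin N → ℝ))).map (histories t.isLt.le) ⊗ₘ K := rfl
      rw [this, Measure.compProd_apply hG.measurableSet, lintegral_map
        (Kernel.measurable_kernel_prodMk_left hG.measurableSet) (measurable_histories _)]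
      simp only [hfK]
    refine (hint γ).trans_le (le_of_le_of_eq ?_ (congrArg (fun u => liminf u (𝓝[couplings μ ν] γ))
      (funext hint).symm))
    refine lowerSemicontinuousOn_iff_le_liminf.1 (lowerSemicontinuousOn_lintegral hf
      (C := couplings μ ν) fun γ hγ => ?_) γ hγ
    have : ∀ᵐ x ∂(γ : Measure ((Fin N → ℝ) × (Fin N → ℝ))).fst, x ∈ μ.support := by
      rw [hγ.1]; exact ae_mem_support _
    exact (ae_of_ae_map measurable_fst.aemeasurable this).mono fun ω hω => ⟨hω, mem_univ _⟩
  convert (((ProbabilityMeasure.continuous_map hm).continuousOn (s := couplings μ ν)).prodMk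
    hΛc).preimage_isClosed_of_isClosed hcl isClosed_diagonal using 1
  ext γ
  refine and_congr_right fun _ => ?_
  exact ⟨fun h => Subtype.ext h, fun h => congrArg Subtype.val h⟩

theorem isCompact_bicausalPlans {κ : RegularKernels μ} {η : RegularKernels ν}
    (hκ : κ.WeaklyContinuous) (hη : η.WeaklyContinuous) : IsCompact (bicausalPlans μ ν) := by
  refine (isCompact_couplings μ ν).of_isClosed_subset ?_ fun γ hγ => hγ.1.1
  have h1 := fun t => hκ.isClosed_setOf_stepCausal (ν := ν) t
  have h2 := fun t => (hη.isClosed_setOf_stepCausal (ν := μ) t).preimage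
    (ProbabilityMeasure.continuous_map continuous_swap)
  convert (isCompact_couplings μ ν).isClosed.inter (isClosed_iInter fun t => (h1 t).inter (h2 t))
    using 1
  ext γ
  simp only [mem_bicausalPlans_iff κ η, mem_inter_iff, mem_iInter]
  exact ⟨fun h => ⟨h.1, fun t => ⟨⟨h.1, (h.2 t).1⟩, swap_mem_couplings h.1, (h.2 t).2⟩⟩,
    fun h => ⟨h.1, fun t => ⟨(h.2 t).1.2, (h.2 t).2.2⟩⟩⟩

end Compactness

/-! ### Semicontinuous costs -/

section Semicontinuous

variable {N : ℕ} {μ ν : Measure (Fin N → ℝ)} [IsProbabilityMeasure μ] [IsProbabilityMeasure ν]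

theorem lowerSemicontinuousOn_coe_sub_iff {α : Type*} [TopologicalSpace α] {f : α → ℝ≥0∞}
    {b : NNReal} {s : Set α} :
    LowerSemicontinuousOn (fun a => (f a : EReal) - ((b : ℝ≥0∞) : EReal)) s
      ↔ LowerSemicontinuousOn f s := by
  refine ⟨fun h x hx a ha => ?_, fun h =>
    (continuous_coe_sub b).comp_lowerSemicontinuousOn h (strictMono_coe_sub b).monotone⟩
  filter_upwards [h x hx _ (strictMono_coe_sub b ha)] with y hy
  exact (strictMono_coe_sub b).lt_iff_lt.1 hy

/-- Backward induction. The next value function is semicontinuous only on the projected supports,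
but from histories there every admissible coupling is concentrated on them, so a globally
semicontinuous extension `g` can replace it. -/
theorem lowerSemicontinuousOn_costFn {κ : RegularKernels μ} {η : RegularKernels ν}
    (hκ : κ.WeaklyContinuous) (hη : η.WeaklyContinuous) {c : (Fin N → ℝ) × (Fin N → ℝ) → ℝ≥0∞}
    (hc : LowerSemicontinuousOn c (μ.support ×ˢ ν.support)) (t : ℕ) (ht : t ≤ N) :
    LowerSemicontinuousOn (fun p : (Fin t → ℝ) × (Fin t → ℝ) => costFn κ η c t ht p.1 p.2)
      (supportHead ht μ ×ˢ supportHead ht ν) := by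
  induction ht using Nat.decreasingInduction with
  | self =>
    simp only [costFn_last, supportHead, head_rfl, image_id]
    exact hc
  | of_succ t ht ih =>
    let t' : Fin N := ⟨t, ht⟩
    obtain ⟨g, hg, hfg⟩ := exists_lowerSemicontinuous_eqOn ih
    let φ : ((Fin t → ℝ) × (Fin t → ℝ)) × (ℝ × ℝ) → (Fin (t + 1) → ℝ) × (Fin (t + 1) → ℝ) :=
      fun q => (snocPath q.1.1 q.2.1, snocPath q.1.2 q.2.2)
    have hφ : Continuous φ := by fun_prop
    have heq : ∀ p ∈ supportHead ht.le μ ×ˢ supportHead ht.le ν,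
        costFn κ η c t ht.le p.1 p.2 = ⨅ γ ∈ couplings (κ.stepLaw t' p.1 : Measure ℝ)
          (η.stepLaw t' p.2 : Measure ℝ), ∫⁻ r, g (φ (p, r)) ∂(γ : Measure (ℝ × ℝ)) := by
      intro p hp
      refine (costFn_of_lt κ η c t' p.1 p.2).trans (iInf_congr fun γ => iInf_congr fun hγ =>
        lintegral_congr_ae ?_)
      have h1 := hκ.ae_snocPath_mem_supportHead t' hp.1
      have h2 := hη.ae_snocPath_mem_supportHead t' hp.2
      rw [← hγ.1] at h1
      rw [← hγ.2] at h2
      filter_upwards [ae_of_ae_map measurable_fst.aemeasurable h1,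
        ae_of_ae_map measurable_snd.aemeasurable h2] with r hr1 hr2
        using hfg (x := φ (p, r)) ⟨hr1, hr2⟩
    refine (lowerSemicontinuousOn_congr fun p hp => heq p hp).2
      (lowerSemicontinuousOn_iInf_lintegral_couplings
      ((hκ.continuousOn_stepLaw t').comp continuousOn_fst fun p hp => hp.1)
      ((hη.continuousOn_stepLaw t').comp continuousOn_snd fun p hp => hp.2)
      (hg.comp hφ))

theorem exists_isMinOn_bicausalPlans {κ : RegularKernels μ} {η : RegularKernels ν}
    (hκ : κ.WeaklyContinuous) (hη : η.WeaklyContinuous) {c : (Fin N → ℝ) × (Fin N → ℝ) → ℝ≥0∞}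
    (hm : Measurable c) (hc : LowerSemicontinuousOn c (μ.support ×ˢ ν.support)) :
    ∃ γ ∈ bicausalPlans μ ν, ∫⁻ ω, c ω ∂(γ : Measure ((Fin N → ℝ) × (Fin N → ℝ)))
      = ⨅ γ ∈ bicausalPlans μ ν, ∫⁻ ω, c ω ∂(γ : Measure ((Fin N → ℝ) × (Fin N → ℝ))) := by
  -- Only the existence of some bicausal plan is used here.
  obtain ⟨γ₀, hγ₀, -⟩ := exists_near_optimal_bicausal κ η hm one_ne_zero
  obtain ⟨γ, hγ, hmin⟩ := LowerSemicontinuousOn.exists_isMinOn ⟨γ₀, hγ₀⟩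
    (isCompact_bicausalPlans hκ hη)
    (lowerSemicontinuousOn_lintegral hc fun γ hγ => ae_mem_support_prod hγ.1.1)
  exact ⟨γ, hγ, le_antisymm (le_iInf₂ fun γ' hγ' => hmin hγ') (iInf₂_le γ hγ)⟩

theorem exists_extIntegral_eq_bicausalValue {κ : RegularKernels μ} {η : RegularKernels ν}
    (hκ : κ.WeaklyContinuous) (hη : η.WeaklyContinuous)
    {c : (Fin N → ℝ) × (Fin N → ℝ) → EReal} (hm : Measurable c)
    (hbdd : ∃ m : ℝ, ∀ p, (m : EReal) ≤ c p)
    (hc : LowerSemicontinuousOn c (μ.support ×ˢ ν.support)) :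
    ∃ γ ∈ bicausalPlans μ ν,
      extIntegral (γ : Measure ((Fin N → ℝ) × (Fin N → ℝ))) c = bicausalValue μ ν c := by
  obtain ⟨f, b, hf, rfl⟩ := exists_eq_coe_sub hm hbdd
  obtain ⟨γ, hγ, h⟩ := exists_isMinOn_bicausalPlans hκ hη hf
    (lowerSemicontinuousOn_coe_sub_iff.1 hc)
  exact ⟨γ, hγ, by rw [extIntegral_coe_sub hf.aemeasurable, bicausalValue_coe_sub hf, h]⟩

theorem lowerSemicontinuousOn_valueFn {κ : RegularKernels μ} {η : RegularKernels ν}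
    (hκ : κ.WeaklyContinuous) (hη : η.WeaklyContinuous)
    {c : (Fin N → ℝ) × (Fin N → ℝ) → EReal} (hm : Measurable c)
    (hbdd : ∃ m : ℝ, ∀ p, (m : EReal) ≤ c p)
    (hc : LowerSemicontinuousOn c (μ.support ×ˢ ν.support)) (t : ℕ) (ht : t ≤ N) :
    LowerSemicontinuousOn (fun p : (Fin t → ℝ) × (Fin t → ℝ) => valueFn κ η c t ht p.1 p.2)
      (supportHead ht μ ×ˢ supportHead ht ν) := by
  obtain ⟨f, b, hf, rfl⟩ := exists_eq_coe_sub hm hbdd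
  simp only [valueFn_coe_sub κ η hf b]
  exact lowerSemicontinuousOn_coe_sub_iff.2 (lowerSemicontinuousOn_costFn hκ hη
    (lowerSemicontinuousOn_coe_sub_iff.1 hc) t ht)

end Semicontinuous

end

end BicausalOT

theorem mainTheorem7 (N : ℕ) (hN : 1 ≤ N) (μ ν : Measure (Fin N → ℝ))
    [IsProbabilityMeasure μ] [IsProbabilityMeasure ν]
    (c : (Fin N → ℝ) × (Fin N → ℝ) → EReal) (hc : Measurable c)
    (hbdd : ∃ m : ℝ, ∀ p, (m : EReal) ≤ c p) :
    -- for all versions of the conditional kernels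
    (∀ (κ : RegularKernels μ) (η : RegularKernels ν),
      -- the successive integrals in the recursion are well-defined
      (∀ (t : Fin N) (x y : Fin t → ℝ), ∀ γ ∈ couplings (κ.step t x) (η.step t y),
        HasExtIntegral (γ : Measure (ℝ × ℝ))
          (fun p => valueFn κ η c (t + 1) t.isLt (snocPath x p.1) (snocPath y p.2))) ∧
      (∀ γ ∈ couplings (μ.map (fun x => x ⟨0, hN⟩)) (ν.map (fun y => y ⟨0, hN⟩)),
        HasExtIntegral (γ : Measure (ℝ × ℝ))
          (fun p => valueFn κ η c 1 hN (fun _ => p.1) (fun _ => p.2))) ∧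
      -- the three values coincide
      dynValue κ η c = bicausalValue μ ν c ∧
      valueZero hN κ η c = bicausalValue μ ν c) ∧
    (LowerSemicontinuousOn c (μ.support ×ˢ ν.support) →
      SuccessivelyWeaklyContinuous μ → SuccessivelyWeaklyContinuous ν →
      -- a bicausal optimizer exists
      (∃ γ ∈ bicausalPlans μ ν,
        extIntegral (γ : Measure ((Fin N → ℝ) × (Fin N → ℝ))) c = bicausalValue μ ν c) ∧
      -- the value functions, for the continuous versions of the kernels, are l.s.c.
      (∀ (κ : RegularKernels μ) (η : RegularKernels ν),
        κ.WeaklyContinuous → η.WeaklyContinuous →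
        ∀ (t : ℕ) (ht : t ≤ N),
          LowerSemicontinuousOn (fun p : (Fin t → ℝ) × (Fin t → ℝ) => valueFn κ η c t ht p.1 p.2)
            (supportHead ht μ ×ˢ supportHead ht ν))) := by
  refine ⟨fun κ η => ⟨fun t x y γ _ => hasExtIntegral_valueFn κ η hc hbdd t.isLt x y _,
    fun γ _ => ?_, dynValue_eq_bicausalValue κ η hc hbdd,
    (valueZero_eq_dynValue hN κ η c).trans (dynValue_eq_bicausalValue κ η hc hbdd)⟩,
    fun hlsc ⟨κ, hκ⟩ ⟨η, hη⟩ => ⟨exists_extIntegral_eq_bicausalValue hκ hη hc hbdd hlsc,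
      fun κ η hκ hη t ht => lowerSemicontinuousOn_valueFn hκ hη hc hbdd hlsc t ht⟩⟩
  simpa only [snocPath_elim0] using
    hasExtIntegral_valueFn κ η hc hbdd (t := 0) hN Fin.elim0 Fin.elim0 (γ : Measure (ℝ × ℝ))
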